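/- Let $G$ and $H$ be finitely generated groups, given by finite generating tuples, and let $G\wr H$ be their restricted wreath product, whose elements are pairs $(f,h)$ with $f\colon H\to G$ finitely supported, $h\in H$, and product $(f,h)(f',h')=(x\mapsto f(x)f'(h^{-1}x),\,hh')$. Write $\sigma(f,h)=h$ and $\tau(f,h)=f$; regard $G$ (functions supported on $\{1\}$, with $h=1$) and $H$ as subgroups of $G\wr H$. Group elements are represented by words over the generators and their inverses. An exponent expression over a group $K$ is a product $E=\alpha_1\cdots\alpha_n$ of atoms, each a constant $g\in K$ or a power $g^x$ with a variable $x$; put $\gamma(\alpha)=g$. Let $P_E$ be the set of indices of powers. $E$ is a knapsack expression if each variable occurs at most once. For a valuation $\nu$ of the variables in $\mathbb N$, $\nu(E)\in K$ is the value of $E$. The problem $\mathrm{ExpEq}(K)$ asks, given a finite set of exponent expressions over $K$, whether one valuation $\nu$ satisfies $\nu(E)=1$ for all of them. An $\mathrm{HKP}^{\pm}(G\wr H)$-instance $(E,L,D)$ consists of a knapsack expression $E=\alpha_1\cdots\alpha_n$ over $G\wr H$, a finite set $L\subseteq[0,n]^2$ of loop constraints, and a finite set $D\subseteq[1,n]^2$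 of disjointness constraints. The valuation $\nu$ induces a walk $\pi_1\cdots\pi_n$, where with $p_i=\nu(\alpha_1\cdots\alpha_{i-1})$ the part $\pi_i$ is $(p_i,p_i\gamma(\alpha_i))$ if $\alpha_i$ is a constant and $(p_i\gamma(\alpha_i)^k)_{0\le k\le\nu(x)}$ if $\alpha_i$ is a power with variable $x$. Let $\mathrm{supp}_E^\nu(i)$ be $\{\sigma(p_i)\}$ if $\alpha_i$ is a constant and $\{\sigma(p_i\gamma(\alpha_i)^k) : 0\le k\le\nu(x)-1\}$ if it is a power with variable $x$. The valuation $\nu$ is a solution if $\nu(E)=1$, the walk $\sigma(\pi_{i+1}\cdots\pi_j)$ has equal first and last points for every $(i,j)\in L$ (for $i>j$ the pair is read as $(j,i)$), and $\mathrm{supp}_E^\nu(i)\cap\mathrm{supp}_E^\nu(j)=\emptyset$ for every $(i,j)\in D$. The instance is normalized if its expression $E=\alpha_1\cdots\alpha_{n+1}$ ends in a constant $\alpha_{n+1}$ and is (i) in $GH$-form: for every $i\in P_E$, $\sigma(\gamma(\alpha_i))=1$ or $\gamma(\alpha_i)\in GH$, and every constant $\alpha_i$ with $i\le n$ lies in $H$;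 (ii) torsion-free: for every $i\in P_E$, $\sigma(\gamma(\alpha_i))$ is $1$ or of infinite order; (iii) c-simplified: for all $i,j\in P_E$ with $\gamma(\alpha_i),\gamma(\alpha_j)\notin H$, if $\sigma(\gamma(\alpha_i))$ and $\sigma(\gamma(\alpha_j))$ are commensurable (have a common power with nonzero integer exponents), then they are equal. An index $i$ is stacking if $i\in P_E$ and $\sigma(\gamma(\alpha_i))=1$, or $i=n+1$ and $\gamma(\alpha_{n+1})\notin H$; the instance is stacking-free if no index is stacking. Lemma. Assume that $\mathrm{ExpEq}(G)$ is decidable and that the word problem of $H$ is decidable (as it is, for example, if the knapsack problem of $H$ is decidable). Then there is an algorithm that computes from every normalized $\mathrm{HKP}^{\pm}(G\wr H)$-instance $I$ a finite set $I_1,\dots,I_t$ of stacking-free normalized $\mathrm{HKP}^{\pm}(G\wr H)$-instances that is equivalent to $I$: $I$ has a solution if and only if some $I_k$ has a solution. -/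

import Mathlib

open RegularWreathProduct

namespace WreathKnapsack

noncomputable section

/-! ### Words over a finite generating tuple -/

/-- Words over the alphabet `A` together with formal inverses; `(x, true)` stands for the letter
`x` and `(x, false)` for its inverse. -/
abbrev Word (A : Type) := List (A × Bool)

/-- The element of `K` represented by a word, the letter `x` standing for `a x`. -/
def evalWord {A : Type} {K : Type*} [Group K] (a : A → K) (w : Word A) : K :=
  (w.map fun p => if p.2 then a p.1 else (a p.1)⁻¹).prod

/-- The word problem for the group generated by the tuple `a` is decidable. -/
def WordProblemDecidable {n : ℕ} {K : Type*} [Group K] (a : Fin n → K) : Prop :=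
  ComputablePred fun w : Word (Fin n) => evalWord a w = 1

/-! ### Exponent expressions and knapsack expressions -/

/-- An atom: `(g, none)` is the constant `g`, and `(g, some x)` is the power `g ^ x` with the
variable `x`. Here `K` is a group, or a type of words representing group elements. -/
abbrev Atom (K : Type*) := K × Option ℕ

/-- The first component `γ(α)` of an atom. -/
def Atom.base {K : Type*} (α : Atom K) : K := α.1

/-- The atom is a power. -/
def Atom.IsPower {K : Type*} (α : Atom K) : Prop := α.2.isSome = true

/-- An exponent expression `α₁ ⋯ αₙ`. -/
abbrev ExpExpr (K : Type*) := List (Atom K)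

/-- A knapsack expression is an exponent expression in which each variable occurs at most once. -/
def IsKnapsack {K : Type*} (E : ExpExpr K) : Prop := (E.filterMap Prod.snd).Nodup

/-- Replace the words occurring in an exponent expression by the elements they represent. -/
def decodeExpr {A : Type} {K : Type*} [Group K] (a : A → K) (E : ExpExpr (Word A)) : ExpExpr K :=
  E.map fun α => (evalWord a α.1, α.2)

/-- The value `ν(α)` of an atom under a valuation of the variables. -/
def atomVal {K : Type*} [Group K] (ν : ℕ → ℕ) : Atom K → K
  | (g, none) => g
  | (g, some x) => g ^ ν x

/-- The value `ν(E)` of an exponent expression under a valuation of the variables. -/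
def exprVal {K : Type*} [Group K] (ν : ℕ → ℕ) (E : ExpExpr K) : K := (E.map (atomVal ν)).prod

/-- Decidability of `ExpEq(K)`, for `K` generated by the tuple `a`: given finitely many exponent
expressions, which may share variables, decide whether some valuation solves all of them. -/
def ExpEqDecidable {n : ℕ} {K : Type*} [Group K] (a : Fin n → K) : Prop :=
  ComputablePred fun S : List (ExpExpr (Word (Fin n))) =>
    ∃ ν : ℕ → ℕ, ∀ E ∈ S, exprVal ν (decodeExpr a E) = 1

/-! ### Walks -/

/-- The walk traversed by an atom when started at `p`: it is `(p, pg)` for a constant `g`, and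
`(p, pg, …, pg ^ ν(x))` for a power `g ^ x`. -/
def atomWalk {K : Type*} [Group K] (ν : ℕ → ℕ) (p : K) : Atom K → List K
  | (g, none) => [p, p * g]
  | (g, some x) => (List.range (ν x + 1)).map fun k => p * g ^ k

/-- The walk induced by an expression when started at `p`: the walks of the atoms are concatenated,
the last point of each being identified with the first point of the next. -/
def walkFrom {K : Type*} [Group K] (ν : ℕ → ℕ) : K → ExpExpr K → List K
  | p, [] => [p]
  | p, α :: E => atomWalk ν p α ++ (walkFrom ν (p * atomVal ν α) E).tail

/-- For `i ≤ j` the part `π_{i+1} ⋯ π_j` of the factorized walk `π₁ ⋯ πₙ` induced by `E`. -/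
def walkSegment {K : Type*} [Group K] (ν : ℕ → ℕ) (E : ExpExpr K) (i j : ℕ) : List K :=
  walkFrom ν (exprVal ν (E.take i)) ((E.take j).drop i)

/-- A walk is a loop if its first point is equal to its last point. -/
def IsLoop {K : Type*} (w : List K) : Prop := w.head? = w.getLast?

/-- The points visited by an atom started at `p`, leaving out the last one: `{p}` for a
constant, and `{p g ^ k | 0 ≤ k ≤ ν(x) - 1}` for a power `g ^ x` (empty if `ν(x) = 0`). -/
def atomPoints {K : Type*} [Group K] (ν : ℕ → ℕ) (p : K) : Atom K → Set K
  | (_, none) => {p}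
  | (g, some x) => {q | ∃ k < ν x, q = p * g ^ k}

/-! ### The restricted wreath product -/

/-- The restricted wreath product `G ≀ H`: pairs `(f, h)` with `f : H → G` of finite support, and
`(f, h) (f', h') = (x ↦ f x * f' (h⁻¹ * x), h * h')`. -/
def restrictedWreath (G H : Type*) [Group G] [Group H] : Subgroup (G ≀ᵣ H) where
  carrier := {u | (Function.mulSupport u.left).Finite}
  one_mem' := by simp
  mul_mem' := by
    intro u v hu hv
    have hv' : (Function.mulSupport fun x => v.left (u.right⁻¹ * x)).Finite :=
      (hv.image (u.right * ·)).subset fun x hx => ⟨u.right⁻¹ * x, hx, by simp⟩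
    exact (hu.union hv').subset (Function.mulSupport_mul _ _)
  inv_mem' := by
    intro u hu
    refine (hu.image (u.right⁻¹ * ·)).subset fun x hx => ⟨u.right * x, ?_, by simp⟩
    simpa [Function.mem_mulSupport] using hx

/-- The restricted wreath product `G ≀ H` as a type. -/
abbrev Wreath (G H : Type*) [Group G] [Group H] := ↥(restrictedWreath G H)

variable {G H : Type*} [Group G] [Group H]

/-- The projection `σ : G ≀ H → H`. -/
def σ (u : Wreath G H) : H := u.1.right

/-- The lamp configuration `τ(u) : H → G`. -/
def τ (u : Wreath G H) : H → G := u.1.left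

open Classical in
/-- The embedding of `G`: the element `g` written at the position `1`. -/
def ofG (g : G) : Wreath G H :=
  ⟨⟨Pi.mulSingle 1 g, 1⟩, (Set.finite_singleton (1 : H)).subset Pi.mulSupport_mulSingle_subset⟩

/-- The embedding of `H`. -/
def ofH (h : H) : Wreath G H := ⟨⟨1, h⟩, by simp [restrictedWreath]⟩

/-- `u ∈ H`, where `H` is regarded as a subgroup of `G ≀ H`. -/
def InH (u : Wreath G H) : Prop := ∃ h : H, u = ofH h

/-- `u ∈ GH`, where `G` and `H` are regarded as subgroups of `G ≀ H`. -/
def InGH (u : Wreath G H) : Prop := ∃ (g : G) (h : H), u = ofG g * ofH h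

/-- The generators of `G ≀ H` given by generators of `G` and of `H`. -/
def wreathGen {m n : ℕ} (a : Fin m → G) (b : Fin n → H) : Fin m ⊕ Fin n → Wreath G H :=
  Sum.elim (fun i => ofG (a i)) (fun j => ofH (b j))

/-! ### The hybrid intersection knapsack problem -/

/-- The data of a hybrid intersection knapsack instance over `G ≀ H`. -/
structure HKP (G H : Type*) [Group G] [Group H] where
  /-- the expression -/
  expr : ExpExpr (Wreath G H)
  /-- the loop constraints -/
  loops : List (ℕ × ℕ)
  /-- the disjointness constraints -/
  disj : List (ℕ × ℕ)

/-- With `n` the number of atoms, the expression is a knapsack expression, the loop constraints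
are in `[0,n]²` and the disjointness constraints are in `[1,n]²`. -/
def HKP.IsInstance (I : HKP G H) : Prop :=
  IsKnapsack I.expr ∧
  (∀ p ∈ I.loops, p.1 ≤ I.expr.length ∧ p.2 ≤ I.expr.length) ∧
  (∀ p ∈ I.disj, p.1 ∈ Set.Icc 1 I.expr.length ∧ p.2 ∈ Set.Icc 1 I.expr.length)

/-- The set `supp_E^ν(i)` of points of `H` visited by the `i`-th atom (counted from `1`), leaving
out the last point. -/
def suppSet (ν : ℕ → ℕ) (E : ExpExpr (Wreath G H)) (i : ℕ) : Set H :=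
  match E[i - 1]? with
  | none => ∅
  | some α => σ '' atomPoints ν (exprVal ν (E.take (i - 1))) α

/-- The set of solutions. A loop constraint `(i, j)` is read as an unordered pair, so that it
concerns the walk between the two positions `i` and `j` also if `i > j`. -/
def HKP.sol (I : HKP G H) : Set (ℕ → ℕ) :=
  {ν | exprVal ν I.expr = 1 ∧
    (∀ p ∈ I.loops, IsLoop ((walkSegment ν I.expr (min p.1 p.2) (max p.1 p.2)).map σ)) ∧
    (∀ p ∈ I.disj, Disjoint (suppSet ν I.expr p.1) (suppSet ν I.expr p.2))}

/-! ### Normalized and stacking-free instances -/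

/-- Two group elements are commensurable if they have a common power with nonzero exponents. -/
def Commensurable {K : Type*} [Group K] (g h : K) : Prop :=
  ∃ x y : ℤ, x ≠ 0 ∧ y ≠ 0 ∧ g ^ x = h ^ y

/-- For each power, `σ(γ(α))` is trivial or of infinite order. -/
def TorsionFreeExpr (E : ExpExpr (Wreath G H)) : Prop :=
  ∀ α ∈ E, α.IsPower → σ α.base = 1 ∨ ¬ IsOfFinOrder (σ α.base)

/-- The expression is `α₁ ⋯ αₙ αₙ₊₁` with a constant `αₙ₊₁`, each power `α` has `σ(γ(α)) = 1` or
`γ(α) ∈ GH`, and each constant other than `αₙ₊₁` is in `H`. -/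
def GHForm (E : ExpExpr (Wreath G H)) : Prop :=
  ∃ (E' : ExpExpr (Wreath G H)) (g : Wreath G H), E = E' ++ [(g, none)] ∧
    ∀ α ∈ E', (α.IsPower → σ α.base = 1 ∨ InGH α.base) ∧ (¬ α.IsPower → InH α.base)

/-- Any two powers whose bases are not in `H` and have commensurable images in `H` have the same
image in `H`. -/
def CSimplified (E : ExpExpr (Wreath G H)) : Prop :=
  ∀ α ∈ E, ∀ β ∈ E, α.IsPower → β.IsPower → ¬ InH α.base → ¬ InH β.base →
    Commensurable (σ α.base) (σ β.base) → σ α.base = σ β.base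

/-- Normalized instances of the hybrid intersection knapsack problem. -/
def HKP.IsNormalized (I : HKP G H) : Prop :=
  I.IsInstance ∧ GHForm I.expr ∧ TorsionFreeExpr I.expr ∧ CSimplified I.expr

/-- The index `i` (counted from `1`) is stacking: either it belongs to a power whose base is
mapped to `1` by `σ`, or it is the last index and its element is not in `H`. -/
def IsStacking (E : ExpExpr (Wreath G H)) (i : ℕ) : Prop :=
  ∃ α, 1 ≤ i ∧ E[i - 1]? = some α ∧
    ((α.IsPower ∧ σ α.base = 1) ∨ (i = E.length ∧ ¬ InH α.base))

/-- The instance has no stacking index. -/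
def HKP.StackingFree (I : HKP G H) : Prop := ∀ i, ¬ IsStacking I.expr i

/-! ### Instances as finite data -/

/-- An instance given by finite data: the elements of `G ≀ H` are words in the generators. -/
abbrev HKPCode (m n : ℕ) :=
  ExpExpr (Word (Fin m ⊕ Fin n)) × List (ℕ × ℕ) × List (ℕ × ℕ)

/-- The instance described by finite data. -/
def HKPCode.decode {m n : ℕ} (a : Fin m → G) (b : Fin n → H) (c : HKPCode m n) : HKP G H where
  expr := decodeExpr (wreathGen a b) c.1
  loops := c.2.1
  disj := c.2.2

end

end WreathKnapsack

open WreathKnapsack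

namespace WreathKnapsack

/-! ### Computable operations on lists -/

section ComputableLists

variable {α β γ δ : Type*} [Primcodable α] [Primcodable β] [Primcodable γ] [Primcodable δ]

theorem computable_option_elim {o : α → Option β} {f : α → γ} {g : α → β → γ} (ho : Computable o)
    (hf : Computable f) (hg : Computable₂ g) : Computable fun a => (o a).elim (f a) (g a) :=
  (Computable.option_casesOn ho hf hg).of_eq fun a => by cases o a <;> rfl

theorem computable_and {f g : α → Bool} (hf : Computable f) (hg : Computable g) :
    Computable fun a => f a && g a :=
  Primrec.and.to_comp.comp hf hg

theorem computable_or {f g : α → Bool} (hf : Computable f) (hg : Computable g) :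
    Computable fun a => f a || g a :=
  Primrec.or.to_comp.comp hf hg

theorem computable_decide_eq [DecidableEq β] {f g : α → β} (hf : Computable f)
    (hg : Computable g) : Computable fun a => decide (f a = g a) :=
  (Primrec.eq (α := β)).decide.to_comp.comp hf hg

theorem computable_range {f : α → ℕ} (hf : Computable f) : Computable fun a => List.range (f a) :=
  Primrec.list_range.to_comp.comp hf

theorem computable_list_map {f : α → List β} {g : α → β → γ} (hf : Computable f)
    (hg : Computable₂ g) : Computable fun a => (f a).map (g a) := by
  have h : Computable₂ fun (a : α) (p : ℕ × List γ) =>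
      p.2 ++ ((f a)[p.1]?).elim [] fun b => [g a b] := by
    refine Computable.list_append.comp (Computable.snd.comp Computable.snd) ?_
    refine computable_option_elim (Computable.list_getElem?.comp (hf.comp Computable.fst)
      (Computable.fst.comp Computable.snd)) (Computable.const []) ?_
    exact Computable.list_cons.comp
      (hg.comp (Computable.fst.comp Computable.fst) Computable.snd) (Computable.const [])
  refine (Computable.nat_rec (Computable.list_length.comp hf) (Computable.const []) h).of_eq ?_
  intro a
  have key : ∀ k ≤ (f a).length, Nat.rec (motive := fun _ => List γ) []
      (fun y IH => IH ++ ((f a)[y]?).elim [] fun b => [g a b]) k = ((f a).take k).map (g a) := by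
    intro k
    induction k with
    | zero => simp
    | succ k ih =>
      intro hk
      have hk' : k < (f a).length := hk
      simp only [ih (Nat.le_of_succ_le hk)]
      rw [List.take_succ_eq_append_getElem hk']
      simp only [List.getElem?_eq_getElem hk', Option.elim_some, List.map_append, List.map_cons,
        List.map_nil]
  simpa using key _ le_rfl

theorem computable_list_flatMap {f : α → List β} {g : α → β → List γ} (hf : Computable f)
    (hg : Computable₂ g) : Computable fun a => (f a).flatMap (g a) :=
  (Primrec.list_flatten.to_comp.comp (computable_list_map hf hg)).of_eq fun a => by
    simp [List.flatMap]

theorem computable_list_filter {f : α → List β} {p : α → β → Bool} (hf : Computable f)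
    (hp : Computable₂ p) : Computable fun a => (f a).filter (p a) := by
  have h : Computable fun a => (f a).flatMap fun b => bif p a b then [b] else [] :=
    computable_list_flatMap hf (Computable.cond hp
      (Computable.list_cons.comp Computable.snd (Computable.const [])) (Computable.const []))
  refine h.of_eq fun a => ?_
  induction f a with
  | nil => rfl
  | cons b l ih => cases hb : p a b <;> simp [hb, ih]

theorem computable_list_any {f : α → List β} {p : α → β → Bool} (hf : Computable f)
    (hp : Computable₂ p) : Computable fun a => (f a).any (p a) := by
  have h := Computable.nat_casesOn (Computable.list_length.comp (computable_list_filter hf hp))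
    (Computable.const false) ((Computable.const true).comp Computable.fst).to₂
  refine h.of_eq fun a => ?_
  induction f a with
  | nil => rfl
  | cons b l ih => cases hb : p a b <;> simp [hb, ← ih]

end ComputableLists

/-! ### Words -/

/-- The formal inverse of a word. -/
def invWord {A : Type} (w : Word A) : Word A := (w.map fun s => (s.1, !s.2)).reverse

/-- The `k`-th letter of a list, counted from `0`, as a list. -/
def letterAt {A : Type} (w : List A) (k : ℕ) : List A := (w.take (k + 1)).drop k

variable {m n : ℕ}

/-- The letters of a word that are generators of `H`. -/
def hPart (w : Word (Fin m ⊕ Fin n)) : Word (Fin m ⊕ Fin n) := w.filter fun s => s.1.isRight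

/-- The letters of a word that are generators of `H`, as a word over the generators of `H`. -/
def hWord (w : Word (Fin m ⊕ Fin n)) : Word (Fin n) :=
  w.flatMap fun s => s.1.elim (fun _ => []) fun j => [(j, s.2)]

/-- The letters of a word that are generators of `G`, as a word over the generators of `G`. -/
def gWord (w : Word (Fin m ⊕ Fin n)) : Word (Fin m) :=
  w.flatMap fun s => s.1.elim (fun i => [(i, s.2)]) fun _ => []

section Oracle

variable (triv : Word (Fin m ⊕ Fin n) → Bool)

/-- Compare the points of `H` reached by two words; `triv` decides if a word is mapped to `1`. -/
def samePoint (u v : Word (Fin m ⊕ Fin n)) : Bool := triv (invWord u ++ v)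

/-- A word for the lamp value that `w` produces at the point reached by `u`. -/
def lampWord (w u : Word (Fin m ⊕ Fin n)) : Word (Fin m) :=
  (List.range w.length).flatMap fun k =>
    bif samePoint triv (w.take k) u then gWord (letterAt w k) else []

/-- The lamp value that `w` produces at the point reached by its first `k` letters, charged to the
first visit of that point. -/
def firstVisitWord (w : Word (Fin m ⊕ Fin n)) (k : ℕ) : Word (Fin m) :=
  bif (List.range k).any fun l => samePoint triv (w.take l) (w.take k) then []
  else lampWord triv w (w.take k)

end Oracle

/-! ### Refined expressions -/

/-- An atom of a refined expression: a word, a flag telling whether it is a power, possibly a mark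
consisting of a class, a lamp word and an exponent variable, possibly the index (counted from `1`)
of an atom of the original expression whose support it belongs to, and possibly the number of a
position of the original walk. -/
abbrev Item (m n : ℕ) :=
  Word (Fin m ⊕ Fin n) × Bool × Option (ℕ × Word (Fin m) × Option ℕ) × Option ℕ × Option ℕ

namespace Item

/-- The word of an item. -/
abbrev word (x : Item m n) : Word (Fin m ⊕ Fin n) := x.1

/-- The item is a power. -/
abbrev pow (x : Item m n) : Bool := x.2.1

/-- The mark of an item. -/
abbrev mark (x : Item m n) : Option (ℕ × Word (Fin m) × Option ℕ) := x.2.2.1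

/-- The index of the original atom whose support the item belongs to. -/
abbrev tag (x : Item m n) : Option ℕ := x.2.2.2.1

/-- The number of the original position that the item is placed at. -/
abbrev anchor (x : Item m n) : Option ℕ := x.2.2.2.2

end Item

/-- The trivial constant at the position `i` of the original walk. -/
def anchorItem (i : ℕ) : Item m n := ([], false, none, none, some i)

/-- The trivial constant standing for the support of the original atom `α_{i+1}`. -/
def pointItem (i : ℕ) : Item m n := ([], false, none, some (i + 1), none)

/-- A piece of the original power `α_{i+1}` with base `w`. -/
def powerItem (i : ℕ) (w : Word (Fin m ⊕ Fin n)) : Item m n := (w, true, none, some (i + 1), none)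

section Blocks

variable (triv : Word (Fin m ⊕ Fin n) → Bool)

/-- One step of the original power `α_{i+1}` with base `w`, at a point of the class `c`. -/
def visitItem (i : ℕ) (w : Word (Fin m ⊕ Fin n)) (c : ℕ) : Item m n :=
  (hPart w, false, some (c, lampWord triv w [], none), some (i + 1), none)

/-- The `k`-th letter of `w`, marked by the lamp value that is produced at its point. -/
def letterItem (w : Word (Fin m ⊕ Fin n)) (x : Option ℕ) (k c : ℕ) : Item m n :=
  (hPart (letterAt w k), false, some (c, firstVisitWord triv w k, x), none, none)

/-- The letters of `w`, with the classes `ℓ`. -/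
def letterItems (w : Word (Fin m ⊕ Fin n)) (x : Option ℕ) (ℓ : List ℕ) : List (Item m n) :=
  (List.range w.length).map fun k => letterItem triv w x k (ℓ[k]?.getD 0)

/-- A power with base `w` that visits marked points of the classes `ℓ`. -/
def powerItems (i : ℕ) (w : Word (Fin m ⊕ Fin n)) (ℓ : List ℕ) : List (Item m n) :=
  powerItem i w :: ℓ.flatMap fun c => [visitItem triv i w c, powerItem i w]

/-- All lists of length `k` with entries less than `N`. -/
def listsOfLength (N k : ℕ) : List (List ℕ) :=
  k.rec [[]] fun _ acc => acc.flatMap fun l => (List.range N).map fun c => c :: l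

/-- The possible refinements of the atom `α_{i+1}`, with classes less than `N`. -/
def blocks (N i : ℕ) (α : Atom (Word (Fin m ⊕ Fin n))) : List (List (Item m n)) :=
  α.2.elim
    ((listsOfLength N α.1.length).map fun ℓ =>
      anchorItem i :: pointItem i :: letterItems triv α.1 none ℓ)
    fun x => bif triv α.1 then
      [anchorItem i] :: (listsOfLength N α.1.length).map fun ℓ =>
        anchorItem i :: pointItem i :: letterItems triv α.1 (some x) ℓ
    else ((List.range (N + 1)).flatMap (listsOfLength N)).map fun ℓ =>
      anchorItem i :: powerItems triv i α.1 ℓ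

/-- The possible refinements of the first `k` atoms of `E`. -/
def prefixRefinements (N : ℕ) (E : ExpExpr (Word (Fin m ⊕ Fin n))) (k : ℕ) :
    List (List (Item m n)) :=
  k.rec [[]] fun j acc =>
    acc.flatMap fun e => ((E[j]?).elim [] (blocks triv N j)).map fun b => e ++ b

/-- The number of classes used for refinements of `E`. -/
def classBound (E : ExpExpr (Word (Fin m ⊕ Fin n))) : ℕ := (E.flatMap Prod.fst).length

/-- The possible refinements of `E`. -/
def refinements (E : ExpExpr (Word (Fin m ⊕ Fin n))) : List (List (Item m n)) :=
  (prefixRefinements triv (classBound E) E E.length).map fun e => e ++ [anchorItem E.length]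

end Blocks

/-! ### The output -/

/-- The expression given by a list of items, the variable of a power being its index. -/
def outExpr (e : List (Item m n)) : ExpExpr (Word (Fin m ⊕ Fin n)) :=
  (List.range e.length).map fun k =>
    (e[k]?).elim ([], none) fun x => (x.word, bif x.pow then some k else none)

/-- The pairs of indices, counted from `0`, of entries that are related by `r`. -/
def pairsWhere {β : Type*} (r : β → β → Bool) (e : List β) : List (ℕ × ℕ) :=
  (List.range e.length).flatMap fun k => (List.range e.length).flatMap fun l =>
    bif (e[k]?).elim false fun x => (e[l]?).elim false fun y => r x y then [(k, l)] else []

/-- The items have to be at the same point. -/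
def loopRel (L : List (ℕ × ℕ)) (x y : Item m n) : Bool :=
  (L.any fun p => decide (x.anchor = some p.1) && decide (y.anchor = some p.2)) ||
    x.mark.elim false fun p => y.mark.elim false fun q => decide (p.1 = q.1)

/-- The items must have disjoint supports. -/
def disjRel (D : List (ℕ × ℕ)) (x y : Item m n) : Bool :=
  (D.any fun p => decide (x.tag = some p.1) && decide (y.tag = some p.2)) ||
    x.mark.elim false fun p => y.pow || y.mark.elim false fun q => !decide (p.1 = q.1)

/-- The instance given by a refinement and by the original constraints. -/
def outCode (L D : List (ℕ × ℕ)) (e : List (Item m n)) : HKPCode m n :=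
  (outExpr e, pairsWhere (loopRel L) e,
    (pairsWhere (disjRel D) e).map fun p => (p.1 + 1, p.2 + 1))

/-- The lamp value at the points of the class `c`, as an exponent expression. -/
def classExpr (e : List (Item m n)) (c : ℕ) : ExpExpr (Word (Fin m)) :=
  e.flatMap fun x => x.mark.elim [] fun p =>
    bif decide (p.1 = c) then (p.2.1, none) :: p.2.2.elim [] fun y => [(p.2.1, some y)] else []

/-- The exponent equations of a refinement. -/
def classExprs (e : List (Item m n)) : List (ExpExpr (Word (Fin m))) :=
  e.map fun x => classExpr e (x.mark.elim 0 Prod.fst)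

/-- The set of instances computed from `c`; `solv` decides `ExpEq(G)`. -/
def stackingFreeInstances (triv : Word (Fin m ⊕ Fin n) → Bool)
    (solv : List (ExpExpr (Word (Fin m))) → Bool) (c : HKPCode m n) : List (HKPCode m n) :=
  ((refinements triv c.1).filter fun e => solv (classExprs e)).map
    (outCode c.2.1 c.2.2)

/-! ### Computability -/

section Computability

open Computable

theorem computable_invWord : Computable (invWord : Word (Fin m ⊕ Fin n) → _) :=
  list_reverse.comp <| computable_list_map Computable.id <|
    (fst.comp snd).pair (Primrec.not.to_comp.comp (snd.comp snd))

theorem computable_letterAt {A : Type} [Primcodable A] :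
    Computable₂ (letterAt : List A → ℕ → List A) :=
  Primrec.list_drop.to_comp.comp snd
    (Primrec.list_take.to_comp.comp (succ.comp snd) fst)

theorem computable_gWord : Computable (gWord : Word (Fin m ⊕ Fin n) → _) := by
  refine computable_list_flatMap Computable.id ?_
  refine (sumCasesOn (fst.comp snd) (g := fun p i => [(i, p.2.2)]) (h := fun _ _ => [])
    ?_ (const _)).of_eq ?_
  · exact list_cons.comp (snd.pair (snd.comp (snd.comp fst))) (const [])
  · rintro ⟨w, s | s, t⟩ <;> rfl

theorem computable_hWord : Computable (hWord : Word (Fin m ⊕ Fin n) → _) := by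
  refine computable_list_flatMap Computable.id ?_
  refine (sumCasesOn (fst.comp snd) (g := fun _ _ => []) (h := fun p i => [(i, p.2.2)])
    (const _) ?_).of_eq ?_
  · exact list_cons.comp (snd.pair (snd.comp (snd.comp fst))) (const [])
  · rintro ⟨w, s | s, t⟩ <;> rfl

theorem computable_hPart : Computable (hPart : Word (Fin m ⊕ Fin n) → _) := by
  refine computable_list_filter Computable.id ?_
  refine (sumCasesOn (fst.comp snd) (g := fun _ _ => false) (h := fun _ _ => true)
    (const _) (const _)).of_eq ?_
  rintro ⟨w, s | s, t⟩ <;> rfl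

variable {α : Type*} [Primcodable α] {triv : Word (Fin m ⊕ Fin n) → Bool}

theorem computable_samePoint (ht : Computable triv) : Computable₂ (samePoint triv) :=
  ht.comp (list_append.comp (computable_invWord.comp fst) snd)

theorem computable_lampWord (ht : Computable triv) : Computable₂ (lampWord triv) := by
  refine computable_list_flatMap (computable_range (list_length.comp fst)) ?_
  refine Computable.cond ?_ (computable_gWord.comp (computable_letterAt.comp (fst.comp fst) snd))
    (const [])
  exact (computable_samePoint ht).comp (Primrec.list_take.to_comp.comp snd (fst.comp fst))
    (snd.comp fst)

theorem computable_firstVisitWord (ht : Computable triv) : Computable₂ (firstVisitWord triv) := by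
  have h : Computable fun p : Word (Fin m ⊕ Fin n) × ℕ => p.1.take p.2 :=
    Primrec.list_take.to_comp.comp snd fst
  refine Computable.cond (computable_list_any (computable_range snd) ?_) (const [])
    ((computable_lampWord ht).comp fst h)
  exact (computable_samePoint ht).comp (Primrec.list_take.to_comp.comp snd (fst.comp fst))
    (h.comp fst)

theorem computable_listsOfLength : Computable₂ listsOfLength := by
  refine Computable.nat_rec (h := fun (p : ℕ × ℕ) (q : ℕ × List (List ℕ)) =>
    q.2.flatMap fun l => (List.range p.1).map fun c => c :: l) snd (const [[]]) ?_
  refine computable_list_flatMap (snd.comp snd) ?_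
  refine computable_list_map (computable_range (fst.comp (fst.comp fst))) ?_
  exact list_cons.comp snd (snd.comp fst)

theorem computable_anchorItem : Computable (anchorItem : ℕ → Item m n) :=
  (const _).pair ((const _).pair ((const _).pair ((const _).pair option_some)))

theorem computable_pointItem : Computable (pointItem : ℕ → Item m n) :=
  (const _).pair ((const _).pair ((const _).pair ((option_some.comp succ).pair (const _))))

theorem computable_powerItem : Computable₂ (powerItem : ℕ → _ → Item m n) :=
  snd.pair ((const _).pair ((const _).pair ((option_some.comp (succ.comp fst)).pair (const _))))

theorem computable_visitItem {f : α → ℕ} {g : α → Word (Fin m ⊕ Fin n)} {h : α → ℕ}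
    (ht : Computable triv) (hf : Computable f) (hg : Computable g) (hh : Computable h) :
    Computable fun a => visitItem triv (f a) (g a) (h a) :=
  (computable_hPart.comp hg).pair <| (const _).pair <|
    (option_some.comp <| hh.pair <|
      ((computable_lampWord ht).comp hg (const [])).pair (const none)).pair <|
    (option_some.comp (succ.comp hf)).pair (const _)

theorem computable_letterItem {f : α → Word (Fin m ⊕ Fin n)} {x : α → Option ℕ} {k c : α → ℕ}
    (ht : Computable triv) (hf : Computable f) (hx : Computable x) (hk : Computable k) (hc : Computable c) :
    Computable fun a => letterItem triv (f a) (x a) (k a) (c a) :=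
  (computable_hPart.comp (computable_letterAt.comp hf hk)).pair <|
    (const _).pair <| (option_some.comp <| hc.pair <|
      ((computable_firstVisitWord ht).comp hf hk).pair hx).pair <| (const _).pair (const _)

theorem computable_letterItems {f : α → Word (Fin m ⊕ Fin n)} {x : α → Option ℕ} {l : α → List ℕ}
    (ht : Computable triv) (hf : Computable f) (hx : Computable x) (hl : Computable l) :
    Computable fun a => letterItems triv (f a) (x a) (l a) := by
  refine computable_list_map (computable_range (list_length.comp hf)) ?_
  exact computable_letterItem ht (hf.comp fst) (hx.comp fst) snd
    (option_getD (list_getElem?.comp (hl.comp fst) snd) (const 0))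

theorem computable_powerItems {i : α → ℕ} {f : α → Word (Fin m ⊕ Fin n)} {l : α → List ℕ}
    (ht : Computable triv) (hi : Computable i) (hf : Computable f) (hl : Computable l) :
    Computable fun a => powerItems triv (i a) (f a) (l a) := by
  refine list_cons.comp (computable_powerItem.comp hi hf) ?_
  refine computable_list_flatMap hl ?_
  refine list_cons.comp (computable_visitItem ht (hi.comp fst) (hf.comp fst) snd) ?_
  exact list_cons.comp (computable_powerItem.comp (hi.comp fst) (hf.comp fst)) (const [])

theorem computable_blocks {N i : α → ℕ} {β : α → Atom (Word (Fin m ⊕ Fin n))}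
    (ht : Computable triv) (hN : Computable N) (hi : Computable i) (hβ : Computable β) :
    Computable fun a => blocks triv (N a) (i a) (β a) := by
  have hw : Computable fun a => (β a).1 := fst.comp hβ
  have hl : Computable fun a => listsOfLength (N a) (β a).1.length :=
    computable_listsOfLength.comp hN (list_length.comp hw)
  refine computable_option_elim (snd.comp hβ) ?_ ?_
  · refine computable_list_map hl ?_
    refine list_cons.comp (computable_anchorItem.comp (hi.comp fst)) ?_
    refine list_cons.comp (computable_pointItem.comp (hi.comp fst)) ?_
    exact computable_letterItems ht (hw.comp fst) (const none) snd
  · refine Computable.cond (ht.comp (hw.comp fst)) ?_ ?_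
    · refine list_cons.comp (list_cons.comp (computable_anchorItem.comp (hi.comp fst)) (const []))
        ?_
      refine computable_list_map (hl.comp fst) ?_
      refine list_cons.comp (computable_anchorItem.comp (hi.comp (fst.comp fst))) ?_
      refine list_cons.comp (computable_pointItem.comp (hi.comp (fst.comp fst))) ?_
      exact computable_letterItems ht (hw.comp (fst.comp fst))
        (option_some.comp (snd.comp fst)) snd
    · have hr : Computable fun a => (List.range (N a + 1)).flatMap (listsOfLength (N a)) :=
        computable_list_flatMap (computable_range (succ.comp hN))
          (computable_listsOfLength.comp (hN.comp fst) snd)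
      refine computable_list_map (hr.comp fst) ?_
      refine list_cons.comp (computable_anchorItem.comp (hi.comp (fst.comp fst))) ?_
      exact computable_powerItems (α := (α × ℕ) × List ℕ) ht (hi.comp (fst.comp fst)) (hw.comp (fst.comp fst)) snd

theorem computable_classBound : Computable (classBound (m := m) (n := n)) :=
  list_length.comp (computable_list_flatMap Computable.id (fst.comp snd))

theorem computable_refinements (ht : Computable triv) : Computable (refinements triv) := by
  refine computable_list_map ?_ ?_
  · refine Computable.nat_rec
      (h := fun (E : ExpExpr (Word (Fin m ⊕ Fin n))) (q : ℕ × List (List (Item m n))) =>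
        q.2.flatMap fun e =>
          ((E[q.1]?).elim [] (blocks triv (classBound E) q.1)).map fun b => e ++ b)
      list_length (const [[]]) ?_
    refine computable_list_flatMap (snd.comp snd) ?_
    refine computable_list_map ?_ ?_
    · refine computable_option_elim
        (list_getElem?.comp (fst.comp fst) (fst.comp (snd.comp fst))) (const []) ?_
      exact computable_blocks ht (computable_classBound.comp (fst.comp (fst.comp fst)))
        (fst.comp (snd.comp (fst.comp fst))) snd
    · exact list_append.comp (snd.comp fst) snd
  · exact list_append.comp snd (list_cons.comp
      (computable_anchorItem.comp (list_length.comp fst)) (const []))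

theorem computable_outExpr : Computable (outExpr : List (Item m n) → _) := by
  refine computable_list_map (computable_range list_length) ?_
  refine computable_option_elim (list_getElem?.comp fst snd) (const _) ?_
  exact (fst.comp snd).pair (Computable.cond (fst.comp (snd.comp snd))
    (option_some.comp (snd.comp fst)) (const none))

theorem computable_pairsWhere {β : Type*} [Primcodable β]
    {r : α → β → β → Bool} {e : α → List (β)}
    (hr : Computable fun p : (α × β) × β => r p.1.1 p.1.2 p.2) (he : Computable e) :
    Computable fun a => pairsWhere (r a) (e a) := by
  have hl : Computable fun a => List.range (e a).length := computable_range (list_length.comp he)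
  have h : Computable fun p : (((α × ℕ) × ℕ) × β) × β =>
      ((p.1.1.1.1, p.1.2), p.2) :=
    ((fst.comp (fst.comp (fst.comp fst))).pair (snd.comp fst)).pair snd
  have h₁ : Computable fun p : (((α × ℕ) × ℕ) × β) × β =>
      r p.1.1.1.1 p.1.2 p.2 := by
    have h' := hr.comp h
    exact h'
  have h₂ : Computable fun p : ((α × ℕ) × ℕ) × β =>
      ((e p.1.1.1)[p.1.2]?).elim false fun y => r p.1.1.1 p.2 y :=
    computable_option_elim
      (list_getElem?.comp (he.comp (fst.comp (fst.comp fst))) (snd.comp fst)) (const false) h₁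
  have h₃ : Computable fun p : (α × ℕ) × ℕ => ((e p.1.1)[p.1.2]?).elim false fun x =>
      ((e p.1.1)[p.2]?).elim false fun y => r p.1.1 x y :=
    computable_option_elim (list_getElem?.comp (he.comp (fst.comp fst)) (snd.comp fst))
      (const false) h₂
  have h₄ : Computable fun p : (α × ℕ) × ℕ => [(p.1.2, p.2)] :=
    list_cons.comp ((snd.comp fst).pair snd) (const [])
  refine computable_list_flatMap hl ?_
  exact computable_list_flatMap (hl.comp fst) (Computable.cond h₃ h₄ (const []))

theorem computable_loopRel {L : α → List (ℕ × ℕ)} {x y : α → Item m n} (hL : Computable L)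
    (hx : Computable x) (hy : Computable y) : Computable fun a => loopRel (L a) (x a) (y a) := by
  have hm : Computable fun x : Item m n => x.mark := fst.comp (snd.comp snd)
  have ha : Computable fun x : Item m n => x.anchor := snd.comp (snd.comp (snd.comp snd))
  refine computable_or (computable_list_any hL (computable_and ?_ ?_)) ?_
  · exact computable_decide_eq (ha.comp (hx.comp fst)) (option_some.comp (fst.comp snd))
  · exact computable_decide_eq (ha.comp (hy.comp fst)) (option_some.comp (snd.comp snd))
  · refine computable_option_elim (hm.comp hx) (const false) ?_
    refine computable_option_elim (hm.comp (hy.comp fst)) (const false) ?_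
    exact computable_decide_eq (fst.comp (snd.comp fst)) (fst.comp snd)

theorem computable_disjRel {L : α → List (ℕ × ℕ)} {x y : α → Item m n} (hL : Computable L)
    (hx : Computable x) (hy : Computable y) : Computable fun a => disjRel (L a) (x a) (y a) := by
  have hm : Computable fun x : Item m n => x.mark := fst.comp (snd.comp snd)
  have ha : Computable fun x : Item m n => x.tag := fst.comp (snd.comp (snd.comp snd))
  refine computable_or (computable_list_any hL (computable_and ?_ ?_)) ?_
  · exact computable_decide_eq (ha.comp (hx.comp fst)) (option_some.comp (fst.comp snd))
  · exact computable_decide_eq (ha.comp (hy.comp fst)) (option_some.comp (snd.comp snd))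
  · refine computable_option_elim (hm.comp hx) (const false) ?_
    refine computable_or (fst.comp (snd.comp (hy.comp fst))) ?_
    refine computable_option_elim (hm.comp (hy.comp fst)) (const false) ?_
    exact Primrec.not.to_comp.comp
      (computable_decide_eq (fst.comp (snd.comp fst)) (fst.comp snd))

theorem computable_outCode {L D : α → List (ℕ × ℕ)} {e : α → List (Item m n)}
    (hL : Computable L) (hD : Computable D) (he : Computable e) :
    Computable fun a => outCode (L a) (D a) (e a) := by
  refine (computable_outExpr.comp he).pair (Computable.pair ?_ ?_)
  · exact computable_pairsWhere
      (computable_loopRel (hL.comp (fst.comp fst)) (snd.comp fst) snd :) he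
  · refine computable_list_map (computable_pairsWhere
      (computable_disjRel (hD.comp (fst.comp fst)) (snd.comp fst) snd :) he) ?_
    exact (succ.comp (fst.comp snd)).pair (succ.comp (snd.comp snd))

theorem computable_classExpr : Computable₂ (classExpr (m := m) (n := n)) := by
  refine computable_list_flatMap fst ?_
  refine computable_option_elim (fst.comp (snd.comp (snd.comp snd))) (const []) ?_
  refine Computable.cond (computable_decide_eq (fst.comp snd) (snd.comp (fst.comp fst))) ?_
    (const [])
  refine list_cons.comp ((fst.comp (snd.comp snd)).pair (const none)) ?_
  refine computable_option_elim (snd.comp (snd.comp snd)) (const []) ?_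
  exact list_cons.comp ((fst.comp (snd.comp (snd.comp fst))).pair (option_some.comp snd))
    (const [])

theorem computable_classExprs : Computable (classExprs (m := m) (n := n)) := by
  have hm : Computable fun x : Item m n => x.mark.elim 0 Prod.fst :=
    computable_option_elim (fst.comp (snd.comp snd)) (const 0) (fst.comp snd)
  exact computable_list_map Computable.id (computable_classExpr.comp fst (hm.comp snd))

theorem computable_stackingFreeInstances {triv : Word (Fin m ⊕ Fin n) → Bool}
    {solv : List (ExpExpr (Word (Fin m))) → Bool} (ht : Computable triv)
    (hs : Computable solv) : Computable (stackingFreeInstances triv solv) := by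
  refine computable_list_map (computable_list_filter ((computable_refinements ht).comp fst) ?_) ?_
  · exact hs.comp (computable_classExprs.comp snd)
  · exact computable_outCode (fst.comp (snd.comp fst)) (snd.comp (snd.comp fst)) snd

end Computability

section Wreath

variable {G H : Type*} [Group G] [Group H]

@[simp] theorem σ_one : σ (1 : Wreath G H) = 1 := rfl

@[simp] theorem σ_mul (u v : Wreath G H) : σ (u * v) = σ u * σ v := rfl

@[simp] theorem σ_inv (u : Wreath G H) : σ u⁻¹ = (σ u)⁻¹ := rfl

@[simp] theorem σ_pow (u : Wreath G H) (k : ℕ) : σ (u ^ k) = σ u ^ k := by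
  induction k with
  | zero => simp
  | succ k ih => rw [pow_succ, σ_mul, ih, pow_succ]

@[simp] theorem σ_ofG (g : G) : σ (ofG g : Wreath G H) = 1 := rfl

@[simp] theorem σ_ofH (h : H) : σ (ofH h : Wreath G H) = h := rfl

@[simp] theorem τ_one (x : H) : τ (1 : Wreath G H) x = 1 := rfl

@[simp] theorem τ_mul (u v : Wreath G H) (x : H) :
    τ (u * v) x = τ u x * τ v ((σ u)⁻¹ * x) := rfl

open Classical in
theorem τ_ofG (g : G) (x : H) : τ (ofG g : Wreath G H) x = if x = 1 then g else 1 := by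
  simp [τ, ofG, Pi.mulSingle_apply]

@[simp] theorem τ_ofG_one (g : G) : τ (ofG g : Wreath G H) 1 = g := by simp [τ_ofG]

@[simp] theorem τ_ofH (h x : H) : τ (ofH h : Wreath G H) x = 1 := rfl

theorem wreath_ext {u v : Wreath G H} (h₁ : σ u = σ v) (h₂ : ∀ x, τ u x = τ v x) : u = v :=
  Subtype.ext (RegularWreathProduct.ext (funext h₂) h₁)

@[simp] theorem ofG_one : (ofG 1 : Wreath G H) = 1 :=
  wreath_ext rfl fun x => by simp [τ_ofG]

@[simp] theorem ofH_one : (ofH 1 : Wreath G H) = 1 := wreath_ext rfl fun x => by simp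

theorem ofH_mul (h k : H) : (ofH (h * k) : Wreath G H) = ofH h * ofH k :=
  wreath_ext rfl fun x => by simp

theorem ofH_inv (h : H) : (ofH h⁻¹ : Wreath G H) = (ofH h)⁻¹ :=
  (inv_eq_of_mul_eq_one_left (a := (ofH h⁻¹ : Wreath G H)) (by rw [← ofH_mul]; simp)).symm

theorem InH.τ_eq_one {u : Wreath G H} (hu : InH u) (x : H) : τ u x = 1 := by
  obtain ⟨h, rfl⟩ := hu; rfl

theorem InGH.eq {u : Wreath G H} (hu : InGH u) : u = ofG (τ u 1) * ofH (σ u) := by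
  obtain ⟨g, h, rfl⟩ := hu
  simp

theorem InGH.τ_pow_eq_one {u : Wreath G H} (hu : InGH u) {k : ℕ} {x : H}
    (hx : ∀ t < k, x ≠ σ u ^ t) : τ (u ^ k) x = 1 := by
  induction k with
  | zero => simp
  | succ k ih =>
    rw [pow_succ, τ_mul, ih fun t ht => hx t (ht.trans k.lt_succ_self), hu.eq]
    have : x ≠ σ u ^ k := hx k k.lt_succ_self
    simp [τ_ofG, inv_mul_eq_one, this.symm]

theorem τ_pow {u : Wreath G H} (hu : σ u = 1) (k : ℕ) (x : H) : τ (u ^ k) x = τ u x ^ k := by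
  induction k with
  | zero => simp
  | succ k ih => simp [pow_succ, ih, hu]

theorem τ_prod_range (v : ℕ → Wreath G H) (N : ℕ) (x : H) :
    τ (((List.range N).map v).prod) x =
      ((List.range N).map fun k => τ (v k) ((σ ((List.range k).map v).prod)⁻¹ * x)).prod := by
  induction N with
  | zero => simp
  | succ N ih => simp [List.range_succ, ih]

open Classical in
theorem prod_first_visits {X : Type*} (U : ℕ → X) (F : X → G) (x : X) (N : ℕ) :
    ((List.range N).map fun k =>
      if U k = x then (if ∃ l < k, U l = U k then 1 else F (U k)) else 1).prod =
      if ∃ k < N, U k = x then F x else 1 := by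
  induction N with
  | zero => simp
  | succ N ih =>
    rw [List.range_succ, List.map_append, List.prod_append, ih]
    by_cases h : ∃ k < N, U k = x
    · have h' : ∃ k < N + 1, U k = x := by
        obtain ⟨k, hk, e⟩ := h; exact ⟨k, hk.trans N.lt_succ_self, e⟩
      rw [if_pos h, if_pos h']
      by_cases hN : U N = x
      · subst hN; simp [h]
      · simp [hN]
    · rw [if_neg h]
      by_cases hN : U N = x
      · subst hN
        rw [if_pos ⟨N, N.lt_succ_self, rfl⟩]
        simp [h]
      · have h' : ¬ ∃ k < N + 1, U k = x := by
          rintro ⟨k, hk, e⟩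
          rcases Nat.lt_succ_iff_lt_or_eq.1 hk with hk | rfl
          exacts [h ⟨k, hk, e⟩, hN e]
        rw [if_neg h']
        simp [hN]

end Wreath

section Words

variable {A : Type} {K : Type*} [Group K] (a : A → K)

@[simp] theorem evalWord_nil : evalWord a [] = 1 := rfl

@[simp] theorem evalWord_append (u v : Word A) :
    evalWord a (u ++ v) = evalWord a u * evalWord a v := by simp [evalWord]

theorem evalWord_cons (s : A × Bool) (w : Word A) :
    evalWord a (s :: w) = evalWord a [s] * evalWord a w := evalWord_append a [s] w

@[simp] theorem evalWord_invWord (w : Word A) : evalWord a (invWord w) = (evalWord a w)⁻¹ := by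
  induction w with
  | nil => simp [invWord]
  | cons s w ih =>
    have : invWord (s :: w) = invWord w ++ [(s.1, !s.2)] := by simp [invWord]
    rw [this, evalWord_append, ih, evalWord_cons a s w, mul_inv_rev]
    rcases s with ⟨s, _ | _⟩ <;> simp [evalWord]

theorem letterAt_eq {w : List A} {k : ℕ} (hk : k < w.length) : letterAt w k = [w[k]] := by
  rw [letterAt, List.take_succ_eq_append_getElem hk, List.drop_append_of_le_length (by simp; omega)]
  simp

theorem evalWord_flatMap_range {ι : Type*} (l : List ι) (f : ι → Word A) :
    evalWord a (l.flatMap f) = (l.map fun k => evalWord a (f k)).prod := by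
  induction l with
  | nil => rfl
  | cons k l ih => simp [ih]

theorem prod_letterAt (w : Word A) {k : ℕ} (hk : k ≤ w.length) :
    ((List.range k).map fun l => evalWord a (letterAt w l)).prod = evalWord a (w.take k) := by
  induction k with
  | zero => simp
  | succ k ih =>
    rw [List.range_succ, List.map_append, List.prod_append, ih (Nat.le_of_succ_le hk),
      List.take_succ_eq_append_getElem hk, evalWord_append, ← letterAt_eq hk]
    simp

end Words

section WreathWords

variable {G H : Type*} [Group G] [Group H] {m n : ℕ} (a : Fin m → G) (b : Fin n → H)

theorem σ_evalWord (w : Word (Fin m ⊕ Fin n)) :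
    σ (evalWord (wreathGen a b) w) = evalWord b (hWord w) := by
  induction w with
  | nil => rfl
  | cons s w ih =>
    have : hWord (s :: w) = hWord [s] ++ hWord w := by simp [hWord]
    rw [this, evalWord_append, ← ih, evalWord_cons, σ_mul]
    congr 1
    rcases s with ⟨s | s, _ | _⟩ <;> simp [evalWord, hWord, wreathGen]

theorem evalWord_hPart (w : Word (Fin m ⊕ Fin n)) :
    evalWord (wreathGen a b) (hPart w) = ofH (σ (evalWord (wreathGen a b) w)) := by
  induction w with
  | nil => simp [hPart]
  | cons s w ih =>
    have : hPart (s :: w) = hPart [s] ++ hPart w := by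
      simp only [hPart]; rw [← List.filter_append]; rfl
    rw [this, evalWord_append, ih, evalWord_cons, σ_mul, ofH_mul]
    congr 1
    rcases s with ⟨s | s, _ | _⟩ <;> simp [evalWord, hPart, wreathGen, List.filter_cons, ofH_inv]

open Classical in
theorem τ_evalWord_letterAt {w : Word (Fin m ⊕ Fin n)} {k : ℕ} (hk : k < w.length) (x : H) :
    τ (evalWord (wreathGen a b) (letterAt w k)) x =
      if x = 1 then evalWord a (gWord (letterAt w k)) else 1 := by
  rw [letterAt_eq hk]
  rcases w[k] with ⟨s | s, _ | _⟩
  · have : τ (ofG (a s) : Wreath G H)⁻¹ x = (τ (ofG (a s) : Wreath G H) x)⁻¹ := by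
      have h := τ_mul (ofG (a s) : Wreath G H) (ofG (a s) : Wreath G H)⁻¹ x
      rw [mul_inv_cancel] at h
      simp only [σ_ofG, inv_one, one_mul, τ_one] at h
      exact (inv_eq_of_mul_eq_one_right h.symm).symm
    simp [evalWord, gWord, wreathGen, this, τ_ofG]
    split_ifs <;> simp
  · simp [evalWord, gWord, wreathGen, τ_ofG]
  · simp [evalWord, gWord, wreathGen, ← ofH_inv]
  · simp [evalWord, gWord, wreathGen]

open Classical in
theorem τ_evalWord (w : Word (Fin m ⊕ Fin n)) (x : H) :
    τ (evalWord (wreathGen a b) w) x = ((List.range w.length).map fun k =>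
      if σ (evalWord (wreathGen a b) (w.take k)) = x then evalWord a (gWord (letterAt w k))
      else 1).prod := by
  conv_lhs => rw [← List.take_length (l := w), ← prod_letterAt _ _ le_rfl, τ_prod_range]
  congr 1
  refine List.map_congr_left fun k hk => ?_
  have hk : k < w.length := List.mem_range.1 hk
  rw [prod_letterAt _ _ hk.le, τ_evalWord_letterAt a b hk]
  simp [inv_mul_eq_one]

variable {a b} {triv : Word (Fin m ⊕ Fin n) → Bool}
  (ht : ∀ w, triv w = true ↔ σ (evalWord (wreathGen a b) w) = 1)
include ht

theorem samePoint_iff (u v : Word (Fin m ⊕ Fin n)) : samePoint triv u v = true ↔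
    σ (evalWord (wreathGen a b) u) = σ (evalWord (wreathGen a b) v) := by
  rw [samePoint, ht, evalWord_append, evalWord_invWord, σ_mul, σ_inv, inv_mul_eq_one]

theorem evalWord_lampWord (w u : Word (Fin m ⊕ Fin n)) : evalWord a (lampWord triv w u) =
    τ (evalWord (wreathGen a b) w) (σ (evalWord (wreathGen a b) u)) := by
  classical
  rw [τ_evalWord, lampWord, evalWord_flatMap_range]
  congr 1
  refine List.map_congr_left fun k _ => ?_
  by_cases h : σ (evalWord (wreathGen a b) (w.take k)) = σ (evalWord (wreathGen a b) u)
  · simp [h, (samePoint_iff ht _ _).2 h]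
  · have : samePoint triv (w.take k) u = false := by
      rw [← Bool.not_eq_true, samePoint_iff ht]; exact h
    simp [h, this]

open Classical in
theorem evalWord_firstVisitWord (w : Word (Fin m ⊕ Fin n)) (k : ℕ) :
    evalWord a (firstVisitWord triv w k) =
      if ∃ l < k, σ (evalWord (wreathGen a b) (w.take l)) = σ (evalWord (wreathGen a b) (w.take k))
      then 1
      else τ (evalWord (wreathGen a b) w) (σ (evalWord (wreathGen a b) (w.take k))) := by
  have : ((List.range k).any fun l => samePoint triv (w.take l) (w.take k)) = true ↔
      ∃ l < k, σ (evalWord (wreathGen a b) (w.take l)) =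
        σ (evalWord (wreathGen a b) (w.take k)) := by
    simp [List.any_eq_true, samePoint_iff ht]
  by_cases h : ∃ l < k, σ (evalWord (wreathGen a b) (w.take l)) =
      σ (evalWord (wreathGen a b) (w.take k))
  · rw [if_pos h, firstVisitWord, this.2 h]; rfl
  · rw [if_neg h, firstVisitWord, Bool.eq_false_iff.2 fun h' => h (this.1 h'), cond_false,
      evalWord_lampWord ht]

/-- The letters of a word, marked by powers of the lamp values that the word produces. -/
theorem prod_firstVisits (w : Word (Fin m ⊕ Fin n)) (e : ℕ) {u : Wreath G H}
    (hσ : σ u = σ (evalWord (wreathGen a b) w))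
    (hτ : ∀ x, τ u x = τ (evalWord (wreathGen a b) w) x ^ e) :
    ((List.range w.length).map fun k => ofG (evalWord a (firstVisitWord triv w k) ^ e) *
      ofH (σ (evalWord (wreathGen a b) (letterAt w k)))).prod = u := by
  classical
  have hs : ∀ k ≤ w.length, σ (((List.range k).map fun k =>
      (ofG (evalWord a (firstVisitWord triv w k) ^ e) *
        ofH (σ (evalWord (wreathGen a b) (letterAt w k))) : Wreath G H)).prod) =
      σ (evalWord (wreathGen a b) (w.take k)) := by
    intro k hk
    rw [← prod_letterAt _ _ hk]
    clear hk
    induction k with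
    | zero => simp
    | succ k ih => simp [List.range_succ, ih]
  refine wreath_ext ?_ fun x => ?_
  · rw [hs _ le_rfl, hσ, List.take_length]
  · rw [τ_prod_range, hτ]
    have h := prod_first_visits (fun k => σ (evalWord (wreathGen a b) (w.take k)))
      (fun y => τ (evalWord (wreathGen a b) w) y ^ e) x w.length
    have h' : (if ∃ k < w.length, σ (evalWord (wreathGen a b) (w.take k)) = x then
        τ (evalWord (wreathGen a b) w) x ^ e else 1) = τ (evalWord (wreathGen a b) w) x ^ e := by
      split_ifs with hx
      · rfl
      · rw [τ_evalWord, List.prod_eq_one, one_pow]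
        simp only [List.mem_map, List.mem_range]
        rintro g ⟨k, hk, rfl⟩
        exact if_neg fun h => hx ⟨k, hk, h⟩
    rw [h'] at h
    rw [← h]
    congr 1
    refine List.map_congr_left fun k hk => ?_
    rw [hs k (List.mem_range.1 hk).le, evalWord_firstVisitWord ht]
    simp only [τ_mul, τ_ofG, τ_ofH, mul_one, inv_mul_eq_one]
    split_ifs <;> simp

end WreathWords

/-! ### Runs -/

section Place

variable {H : Type*} [Group H] {α : Type*} (s : α → H)

/-- The entries of a list together with the points at which they start, if the first one starts
at `p` and `s` gives the step made by an entry. -/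
def place : H → List α → List (H × α)
  | _, [] => []
  | p, r :: R => (p, r) :: place (p * s r) R

theorem place_append (p : H) (R S : List α) :
    place s p (R ++ S) = place s p R ++ place s (p * (R.map s).prod) S := by
  induction R generalizing p with
  | nil => simp [place]
  | cons r R ih => simp [place, ih, mul_assoc]

theorem place_map_snd (p : H) (R : List α) : (place s p R).map Prod.snd = R := by
  induction R generalizing p with
  | nil => rfl
  | cons r R ih => simp [place, ih]

theorem mem_of_mem_place {p : H} {R : List α} {Y : H × α} (hY : Y ∈ place s p R) : Y.2 ∈ R := by
  rw [← place_map_snd s p R]; exact List.mem_map_of_mem hY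

theorem exists_mem_place (p : H) {R : List α} {r : α} (hr : r ∈ R) :
    ∃ q, (q, r) ∈ place s p R := by
  rw [← place_map_snd s p R] at hr
  obtain ⟨⟨q, _⟩, h, rfl⟩ := List.mem_map.1 hr
  exact ⟨q, h⟩

theorem mem_place_iff {p : H} {R : List α} {Y : H × α} : Y ∈ place s p R ↔
    ∃ k, R[k]? = some Y.2 ∧ Y.1 = p * ((R.take k).map s).prod := by
  induction R generalizing p with
  | nil => simp [place]
  | cons r R ih =>
    rw [place, List.mem_cons, ih]
    constructor
    · rintro (rfl | ⟨k, h₁, h₂⟩)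
      · exact ⟨0, by simp⟩
      · exact ⟨k + 1, by simpa using h₁, by simpa [mul_assoc] using h₂⟩
    · rintro ⟨_ | k, h₁, h₂⟩
      · left; ext <;> simp_all
      · right; exact ⟨k, by simpa using h₁, by simpa [mul_assoc] using h₂⟩

end Place

theorem τ_prod {G H : Type*} [Group G] [Group H] {α : Type*} (v : α → Wreath G H) (s : α → H)
    (hs : ∀ r, σ (v r) = s r) (R : List α) (p x : H) :
    τ ((R.map v).prod) (p⁻¹ * x) =
      ((place s p R).map fun Y => τ (v Y.2) (Y.1⁻¹ * x)).prod := by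
  induction R generalizing p with
  | nil => simp [place]
  | cons r R ih => simp [place, ← ih, mul_assoc, hs]

section Runs

variable {G H : Type*} [Group G] [Group H] {m n : ℕ} (a : Fin m → G) (b : Fin n → H) (η : ℕ → ℕ)

/-- The value of an item without its mark, `r.2` being the exponent. -/
noncomputable def bareVal (r : Item m n × ℕ) : Wreath G H :=
  bif r.1.pow then evalWord (wreathGen a b) r.1.word ^ r.2 else evalWord (wreathGen a b) r.1.word

/-- The step in `H` made by an item. -/
def step (r : Item m n × ℕ) : H :=
  bif r.1.pow then evalWord b (hWord r.1.word) ^ r.2 else evalWord b (hWord r.1.word)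

theorem σ_bareVal (r : Item m n × ℕ) : σ (bareVal a b r) = step b r := by
  rcases h : r.1.pow with _ | _ <;> simp [bareVal, step, σ_evalWord, h]

/-- The lamp value of the mark of an item. -/
def markVal (x : Item m n) : G :=
  x.mark.elim 1 fun p => evalWord a p.2.1 ^ p.2.2.elim 1 fun y => η y + 1

/-- The value of an item including its mark. -/
noncomputable def fullVal (r : Item m n × ℕ) : Wreath G H := ofG (markVal a η r.1) * bareVal a b r

theorem σ_fullVal (r : Item m n × ℕ) : σ (fullVal a b η r) = step b r := by
  simp [fullVal, σ_bareVal]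

/-- The points visited by an item started at `Y.1`, leaving out the last one. -/
def itemSupp (Y : H × Item m n × ℕ) : Set H :=
  bif Y.2.1.pow then {y | ∃ t < Y.2.2, y = Y.1 * evalWord b (hWord Y.2.1.word) ^ t} else {Y.1}

open Classical in
/-- The lamp value given by the marks of the class `c`. -/
def classVal (R : List (Item m n × ℕ)) (c : ℕ) : G :=
  (R.map fun r => if ∃ p, r.1.mark = some p ∧ p.1 = c then markVal a η r.1 else 1).prod

/-- Powers are unmarked with bases in `GH`, and constants are in `H`. -/
def GoodItem (x : Item m n) : Prop :=
  (x.pow = true → x.mark = none ∧ InGH (evalWord (wreathGen a b) x.word)) ∧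
    (x.pow = false → InH (evalWord (wreathGen a b) x.word))

theorem prod_σ (R : List (Item m n × ℕ)) :
    (R.map (step b)).prod = σ (R.map (bareVal a b)).prod := by
  induction R with
  | nil => rfl
  | cons r R ih => simp [ih, σ_bareVal]

theorem prod_σ_fullVal (R : List (Item m n × ℕ)) :
    σ (R.map (fullVal a b η)).prod = (R.map (step b)).prod := by
  induction R with
  | nil => rfl
  | cons r R ih => simp [ih, σ_fullVal]

/-- Marks are at the same point if and only if they have the same class, and powers avoid the
points of the marks. -/
def Separated (P : List (H × Item m n × ℕ)) : Prop :=
  (∀ X ∈ P, ∀ Y ∈ P, ∀ p q, X.2.1.mark = some p → Y.2.1.mark = some q →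
    (p.1 = q.1 ↔ X.1 = Y.1)) ∧
  ∀ X ∈ P, ∀ Y ∈ P, X.2.1.mark ≠ none → Y.2.1.pow = true → X.1 ∉ itemSupp b Y

theorem τ_bareVal_eq_one {Y : H × Item m n × ℕ} (hY : GoodItem a b Y.2.1) {x : H}
    (hx : Y.2.1.pow = true → x ∉ itemSupp b Y) : τ (bareVal a b Y.2) (Y.1⁻¹ * x) = 1 := by
  rcases h : Y.2.1.pow with _ | _
  · rw [bareVal, h, cond_false]
    exact (hY.2 h).τ_eq_one _
  · rw [bareVal, h, cond_true]
    refine (hY.1 h).2.τ_pow_eq_one fun t ht e => hx h ?_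
    rw [itemSupp, h, cond_true]
    exact ⟨t, ht, by rw [← σ_evalWord a b, ← e]; simp⟩

theorem prod_fullVal_eq_one_iff {R : List (Item m n × ℕ)} (hR : ∀ r ∈ R, GoodItem a b r.1)
    (hsep : Separated b (place (step b) 1 R)) :
    (R.map (fullVal a b η)).prod = 1 ↔
      (R.map (bareVal a b)).prod = 1 ∧ ∀ c, classVal a η R c = 1 := by
  classical
  have hfull : ∀ x, τ (R.map (fullVal a b η)).prod x =
      ((place (step b) 1 R).map fun Y => (if Y.1 = x then markVal a η Y.2.1 else 1) *
        τ (bareVal a b Y.2) (Y.1⁻¹ * x)).prod := by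
    intro x
    have h := τ_prod (fullVal a b η) (step b) (σ_fullVal a b η) R 1 x
    rw [inv_one, one_mul] at h
    rw [h]
    congr 1
    refine List.map_congr_left fun Y _ => ?_
    simp [fullVal, τ_ofG, inv_mul_eq_one]
  have hbare : ∀ x, τ (R.map (bareVal a b)).prod x =
      ((place (step b) 1 R).map fun Y => τ (bareVal a b Y.2) (Y.1⁻¹ * x)).prod := by
    intro x
    have h := τ_prod (bareVal a b) (step b) (σ_bareVal a b) R 1 x
    rwa [inv_one, one_mul] at h
  have hA : ∀ x, (∀ Y ∈ place (step b) 1 R, Y.2.1.mark ≠ none → Y.1 ≠ x) →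
      τ (R.map (fullVal a b η)).prod x = τ (R.map (bareVal a b)).prod x := by
    intro x hx
    rw [hfull, hbare]
    congr 1
    refine List.map_congr_left fun Y hY => ?_
    rcases hm : Y.2.1.mark with _ | p
    · simp [markVal, hm]
    · simp [hx Y hY (by simp [hm])]
  have hB : ∀ X ∈ place (step b) 1 R, ∀ p, X.2.1.mark = some p →
      τ (R.map (bareVal a b)).prod X.1 = 1 ∧
      τ (R.map (fullVal a b η)).prod X.1 = classVal a η R p.1 := by
    intro X hX p hp
    have h1 : ∀ Y ∈ place (step b) 1 R, τ (bareVal a b Y.2) (Y.1⁻¹ * X.1) = 1 :=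
      fun Y hY => τ_bareVal_eq_one a b (hR _ (mem_of_mem_place _ hY))
        (hsep.2 X hX Y hY (by simp [hp]))
    constructor
    · rw [hbare]
      refine List.prod_eq_one fun g hg => ?_
      obtain ⟨Y, hY, rfl⟩ := List.mem_map.1 hg
      exact h1 Y hY
    · rw [hfull, classVal]
      conv_rhs => rw [← place_map_snd (step b) 1 R, List.map_map]
      congr 1
      refine List.map_congr_left fun Y hY => ?_
      rw [h1 Y hY, mul_one]
      rcases hm : Y.2.1.mark with _ | q
      · simp [markVal, hm]
      · have := hsep.1 X hX Y hY p q hp hm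
        have e : (∃ p', Y.2.1.mark = some p' ∧ p'.1 = p.1) ↔ Y.1 = X.1 := by
          rw [hm, eq_comm (a := Y.1), ← this]
          exact ⟨fun ⟨p', h₁, h₂⟩ => by rw [Option.some.inj h₁, h₂], fun h => ⟨q, rfl, h.symm⟩⟩
        rw [Function.comp_apply]
        simp only [e]
  constructor
  · intro h
    refine ⟨wreath_ext ?_ fun x => ?_, fun c => ?_⟩
    · rw [← prod_σ, ← prod_σ_fullVal a b η, h]
    · by_cases hx : ∀ Y ∈ place (step b) 1 R, Y.2.1.mark ≠ none → Y.1 ≠ x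
      · rw [← hA x hx, h]
      · push Not at hx
        obtain ⟨Y, hY, hm, rfl⟩ := hx
        obtain ⟨p, hp⟩ := Option.ne_none_iff_exists'.1 hm
        exact (hB Y hY p hp).1
    · by_cases hc : ∃ X ∈ place (step b) 1 R, ∃ p, X.2.1.mark = some p ∧ p.1 = c
      · obtain ⟨X, hX, p, hp, rfl⟩ := hc
        rw [← (hB X hX p hp).2, h]; rfl
      · refine List.prod_eq_one fun g hg => ?_
        obtain ⟨r, hr, rfl⟩ := List.mem_map.1 hg
        obtain ⟨q, hq⟩ := exists_mem_place (step b) 1 hr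
        exact if_neg fun h => hc ⟨_, hq, h⟩
  · rintro ⟨h, hc⟩
    refine wreath_ext ?_ fun x => ?_
    · rw [prod_σ_fullVal a b η, prod_σ a b, h]
    · by_cases hx : ∀ Y ∈ place (step b) 1 R, Y.2.1.mark ≠ none → Y.1 ≠ x
      · rw [hA x hx, h]
      · push Not at hx
        obtain ⟨Y, hY, hm, rfl⟩ := hx
        obtain ⟨p, hp⟩ := Option.ne_none_iff_exists'.1 hm
        rw [(hB Y hY p hp).2, hc]; rfl

/-- The exponent equation of the class `c` says that the lamps of this class are trivial. -/
theorem exprVal_classExpr (R : List (Item m n × ℕ)) (c : ℕ) :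
    exprVal η (decodeExpr a (classExpr (R.map Prod.fst) c)) = classVal a η R c := by
  classical
  induction R with
  | nil => rfl
  | cons r R ih =>
    have h : classExpr ((r :: R).map Prod.fst) c =
        classExpr [r.1] c ++ classExpr (R.map Prod.fst) c := by simp [classExpr]
    have h' : ∀ E F : ExpExpr (Word (Fin m)), exprVal η (decodeExpr a (E ++ F)) =
        exprVal η (decodeExpr a E) * exprVal η (decodeExpr a F) := by
      simp [exprVal, decodeExpr]
    have h'' : classVal a η (r :: R) c =
        (if ∃ p, r.1.mark = some p ∧ p.1 = c then markVal a η r.1 else 1) * classVal a η R c := by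
      simp [classVal]
    rw [h, h', ih, h'']
    congr 1
    rcases hm : r.1.mark with _ | ⟨k, w, _ | y⟩
    · simp [classExpr, hm, exprVal, decodeExpr]
    · by_cases hk : k = c <;>
        simp [classExpr, hm, exprVal, decodeExpr, hk, markVal, atomVal]
    · by_cases hk : k = c <;>
        simp [classExpr, hm, exprVal, decodeExpr, hk, markVal, atomVal, pow_succ']

end Runs

/-! ### Solutions in terms of points -/

section Walk

variable {K : Type*} [Group K] (ν : ℕ → ℕ)

@[simp] theorem exprVal_append (E F : ExpExpr K) :
    exprVal ν (E ++ F) = exprVal ν E * exprVal ν F := by simp [exprVal]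

theorem walkFrom_head_getLast (p : K) (E : ExpExpr K) :
    (walkFrom ν p E).head? = some p ∧ (walkFrom ν p E).getLast? = some (p * exprVal ν E) := by
  induction E generalizing p with
  | nil => simp [walkFrom, exprVal]
  | cons α E ih =>
    have hα : (atomWalk ν p α).head? = some p ∧
        (atomWalk ν p α).getLast? = some (p * atomVal ν α) := by
      rcases α with ⟨g, _ | x⟩
      · simp [atomWalk, atomVal]
      · simp [atomWalk, atomVal, List.range_succ_eq_map, List.getLast?_cons, List.getLast?_map,
          List.getLast?_range]
        rcases ν x with _ | k <;> simp
    obtain ⟨h₁, h₂⟩ := ih (p * atomVal ν α)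
    have hE : exprVal ν (α :: E) = atomVal ν α * exprVal ν E := by simp [exprVal]
    rw [walkFrom, hE, ← mul_assoc]
    rcases hw : walkFrom ν (p * atomVal ν α) E with _ | ⟨q, t⟩
    · simp [hw] at h₁
    · rw [hw] at h₁ h₂
      simp only [List.head?_cons, Option.some.injEq] at h₁
      subst h₁
      rw [List.getLast?_cons, Option.some.injEq] at h₂
      rw [List.head?_append, List.getLast?_append, hα.1, hα.2, ← h₂]
      simp only [List.tail_cons, Option.some_or, true_and]
      rcases t.getLast? with _ | z <;> rfl

variable {G H : Type*} [Group G] [Group H]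

/-- The point of `H` reached after `k` atoms. -/
def pos (E : ExpExpr (Wreath G H)) (k : ℕ) : H := σ (exprVal ν (E.take k))

theorem isLoop_iff (E : ExpExpr (Wreath G H)) {i j : ℕ} (hij : i ≤ j) :
    IsLoop ((walkSegment ν E i j).map σ) ↔ pos ν E i = pos ν E j := by
  have h := walkFrom_head_getLast ν (exprVal ν (E.take i)) ((E.take j).drop i)
  have hE : E.take j = E.take i ++ (E.take j).drop i := by
    conv_lhs => rw [← List.take_append_drop i (E.take j)]
    rw [List.take_take, min_eq_left hij]
  rw [← exprVal_append, ← hE] at h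
  rw [IsLoop, List.head?_map, List.getLast?_map, walkSegment, h.1, h.2]
  simp [pos]

/-- The points of `H` visited by an atom started at `p`, leaving out the last one. -/
def atomSupp (p : H) (α : Atom (Wreath G H)) : Set H :=
  α.2.elim {p} fun x => {y | ∃ t < ν x, y = p * σ α.1 ^ t}

theorem suppSet_eq {E : ExpExpr (Wreath G H)} {k : ℕ} {α : Atom (Wreath G H)}
    (h : E[k]? = some α) : suppSet ν E (k + 1) = atomSupp ν (pos ν E k) α := by
  rcases α with ⟨g, _ | x⟩
  · simp [suppSet, h, atomPoints, atomSupp, pos]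
  · ext y
    simp only [suppSet, Nat.add_sub_cancel, h, atomPoints, atomSupp, pos, Option.elim_some,
      Set.mem_image, Set.mem_ofPred_eq]
    constructor
    · rintro ⟨_, ⟨t, ht, rfl⟩, rfl⟩; exact ⟨t, ht, by simp⟩
    · rintro ⟨t, ht, rfl⟩; exact ⟨_, ⟨t, ht, rfl⟩, by simp⟩

theorem mem_sol_iff (I : HKP G H) : ν ∈ I.sol ↔ exprVal ν I.expr = 1 ∧
    (∀ p ∈ I.loops, pos ν I.expr p.1 = pos ν I.expr p.2) ∧
    ∀ p ∈ I.disj, Disjoint (suppSet ν I.expr p.1) (suppSet ν I.expr p.2) := by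
  rw [HKP.sol, Set.mem_ofPred_eq]
  refine and_congr_right fun _ => and_congr_left fun _ => forall₂_congr fun p _ => ?_
  rw [isLoop_iff ν _ min_le_max]
  rcases le_total p.1 p.2 with h | h
  · rw [min_eq_left h, max_eq_right h]
  · rw [min_eq_right h, max_eq_left h, eq_comm]

end Walk

/-! ### The output instance -/

section Output

variable {G H : Type*} [Group G] [Group H] {m n : ℕ} (a : Fin m → G) (b : Fin n → H)

theorem mem_pairsWhere {β : Type*} {r : β → β → Bool} {e : List β} {p : ℕ × ℕ} :
    p ∈ pairsWhere r e ↔ ∃ x y, e[p.1]? = some x ∧ e[p.2]? = some y ∧ r x y = true := by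
  obtain ⟨k, l⟩ := p
  simp only [pairsWhere, List.mem_flatMap, List.mem_range]
  constructor
  · rintro ⟨k', hk, l', hl, h⟩
    rw [List.getElem?_eq_getElem hk, List.getElem?_eq_getElem hl, Option.elim_some,
      Option.elim_some] at h
    cases hr : r e[k'] e[l'] <;> rw [hr] at h
    · simp at h
    · simp only [cond_true, List.mem_singleton, Prod.mk.injEq] at h
      obtain ⟨rfl, rfl⟩ := h
      exact ⟨_, _, List.getElem?_eq_getElem hk, List.getElem?_eq_getElem hl, hr⟩
  · rintro ⟨x, y, hx, hy, h⟩
    obtain ⟨hk, -⟩ := List.getElem?_eq_some_iff.1 hx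
    obtain ⟨hl, -⟩ := List.getElem?_eq_some_iff.1 hy
    exact ⟨k, hk, l, hl, by simp_all⟩

/-- The items of `e` with the exponents given by a valuation of the indices. -/
def runOf (e : List (Item m n)) (ν : ℕ → ℕ) : List (Item m n × ℕ) := e.mapIdx fun k x => (x, ν k)

theorem runOf_map_fst (e : List (Item m n)) (ν : ℕ → ℕ) : (runOf e ν).map Prod.fst = e := by
  refine List.ext_getElem? fun k => ?_
  rcases h : e[k]? with _ | x <;> simp [runOf, h]

theorem eq_runOf (R : List (Item m n × ℕ)) :
    R = runOf (R.map Prod.fst) fun k => (R[k]?).elim 0 Prod.snd := by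
  refine List.ext_getElem? fun k => ?_
  rcases h : R[k]? with _ | x <;> simp [runOf, h]

theorem outExpr_eq (e : List (Item m n)) :
    outExpr e = e.mapIdx fun k x => (x.word, bif x.pow then some k else none) := by
  refine List.ext_getElem? fun k => ?_
  rcases h : e[k]? with _ | x
  · simp [outExpr, h]; simpa using h
  · have : k < e.length := (List.getElem?_eq_some_iff.1 h).1
    simp [outExpr, this]

theorem map_atomVal_outExpr (e : List (Item m n)) (ν : ℕ → ℕ) :
    (decodeExpr (wreathGen a b) (outExpr e)).map (atomVal ν) = (runOf e ν).map (bareVal a b) := by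
  rw [outExpr_eq]
  refine List.ext_getElem? fun k => ?_
  rcases h : e[k]? with _ | x
  · simp [runOf, decodeExpr, h]
  · rcases h' : x.pow <;> simp [runOf, decodeExpr, h, bareVal, atomVal, h']

theorem pos_outExpr (e : List (Item m n)) (ν : ℕ → ℕ) (k : ℕ) :
    pos ν (decodeExpr (wreathGen a b) (outExpr e)) k =
      (((runOf e ν).take k).map (step b)).prod := by
  rw [pos, exprVal, List.map_take, map_atomVal_outExpr, ← List.map_take, prod_σ a b]

theorem suppSet_outExpr {e : List (Item m n)} {ν : ℕ → ℕ} {k : ℕ} {r : Item m n × ℕ}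
    (h : (runOf e ν)[k]? = some r) :
    suppSet ν (decodeExpr (wreathGen a b) (outExpr e)) (k + 1) =
      itemSupp b ((((runOf e ν).take k).map (step b)).prod, r) := by
  obtain ⟨x, hx, rfl⟩ : ∃ x, e[k]? = some x ∧ (x, ν k) = r := by
    simpa [runOf, Option.map_eq_some_iff] using h
  have h' : (decodeExpr (wreathGen a b) (outExpr e))[k]? =
      some (evalWord (wreathGen a b) x.word, bif x.pow then some k else none) := by
    simp [outExpr_eq, decodeExpr, hx]
  rw [suppSet_eq ν h', pos_outExpr]
  rcases hp : x.pow <;> simp [atomSupp, itemSupp, hp, σ_evalWord]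

theorem mem_sol_outCode_iff (L D : List (ℕ × ℕ)) (e : List (Item m n)) (ν : ℕ → ℕ) :
    ν ∈ (HKPCode.decode a b (outCode L D e)).sol ↔
      ((runOf e ν).map (bareVal a b)).prod = 1 ∧
      (∀ X ∈ place (step b) 1 (runOf e ν), ∀ Y ∈ place (step b) 1 (runOf e ν),
        loopRel L X.2.1 Y.2.1 = true → X.1 = Y.1) ∧
      ∀ X ∈ place (step b) 1 (runOf e ν), ∀ Y ∈ place (step b) 1 (runOf e ν),
        disjRel D X.2.1 Y.2.1 = true → Disjoint (itemSupp b X) (itemSupp b Y) := by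
  have hget : ∀ {k x}, e[k]? = some x → (runOf e ν)[k]? = some (x, ν k) := by
    intro k x h; simp [runOf, h]
  have hget' : ∀ {k : ℕ} {r : Item m n × ℕ}, (runOf e ν)[k]? = some r → e[k]? = some r.1 := by
    intro k r h
    obtain ⟨x, hx, rfl⟩ : ∃ x, e[k]? = some x ∧ (x, ν k) = r := by
      simpa [runOf, Option.map_eq_some_iff] using h
    exact hx
  rw [mem_sol_iff]
  refine and_congr ?_ (and_congr ?_ ?_)
  · show exprVal ν (decodeExpr (wreathGen a b) (outExpr e)) = 1 ↔ _
    rw [exprVal, map_atomVal_outExpr]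
  · show (∀ p ∈ pairsWhere (loopRel L) e,
      pos ν (decodeExpr (wreathGen a b) (outExpr e)) p.1 =
        pos ν (decodeExpr (wreathGen a b) (outExpr e)) p.2) ↔ _
    simp only [pos_outExpr]
    constructor
    · rintro h X hX Y hY hr
      obtain ⟨k, hk, hkp⟩ := (mem_place_iff _).1 hX
      obtain ⟨l, hl, hlp⟩ := (mem_place_iff _).1 hY
      rw [hkp, hlp, one_mul, one_mul]
      exact h (k, l) (mem_pairsWhere.2 ⟨_, _, hget' hk, hget' hl, hr⟩)
    · rintro h ⟨k, l⟩ hp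
      obtain ⟨x, y, hx, hy, hr⟩ := mem_pairsWhere.1 hp
      exact h (_, x, ν k) ((mem_place_iff _).2 ⟨k, hget hx, (one_mul _).symm⟩)
        (_, y, ν l) ((mem_place_iff _).2 ⟨l, hget hy, (one_mul _).symm⟩) hr
  · show (∀ p ∈ (pairsWhere (disjRel D) e).map fun p => (p.1 + 1, p.2 + 1),
      Disjoint (suppSet ν (decodeExpr (wreathGen a b) (outExpr e)) p.1)
        (suppSet ν (decodeExpr (wreathGen a b) (outExpr e)) p.2)) ↔ _
    rw [List.forall_mem_map]
    constructor
    · rintro h ⟨x, r⟩ hX ⟨y, r'⟩ hY hr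
      obtain ⟨k, hk, hkp⟩ := (mem_place_iff _).1 hX
      obtain ⟨l, hl, hlp⟩ := (mem_place_iff _).1 hY
      have := h (k, l) (mem_pairsWhere.2 ⟨_, _, hget' hk, hget' hl, hr⟩)
      rw [one_mul] at hkp hlp
      simp only at hkp hlp
      rwa [suppSet_outExpr a b hk, suppSet_outExpr a b hl, ← hkp, ← hlp] at this
    · rintro h ⟨k, l⟩ hp
      obtain ⟨x, y, hx, hy, hr⟩ := mem_pairsWhere.1 hp
      rw [suppSet_outExpr a b (hget hx), suppSet_outExpr a b (hget hy)]
      exact h (_, x, ν k) ((mem_place_iff _).2 ⟨k, hget hx, (one_mul _).symm⟩)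
        (_, y, ν l) ((mem_place_iff _).2 ⟨l, hget hy, (one_mul _).symm⟩) hr

theorem mem_decodeExpr_outExpr {e : List (Item m n)} {α : Atom (Wreath G H)}
    (h : α ∈ decodeExpr (wreathGen a b) (outExpr e)) : ∃ x ∈ e, ∃ k,
      α = (evalWord (wreathGen a b) x.word, bif x.pow then some k else none) := by
  rw [outExpr_eq, decodeExpr] at h
  obtain ⟨_, h', rfl⟩ := List.mem_map.1 h
  obtain ⟨k, hk, rfl⟩ := List.mem_mapIdx.1 h'
  exact ⟨_, List.getElem_mem hk, k, rfl⟩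

theorem outCode_normalized {c : HKPCode m n} (hc : (HKPCode.decode a b c).IsNormalized)
    {e : List (Item m n)} {i : ℕ}
    (hpow : ∀ x ∈ e, x.pow = true →
      (∃ y, (x.word, some y) ∈ c.1) ∧ σ (evalWord (wreathGen a b) x.word) ≠ 1)
    (hconst : ∀ x ∈ e, x.pow = false → InH (evalWord (wreathGen a b) x.word))
    (L D : List (ℕ × ℕ)) :
    (HKPCode.decode a b (outCode L D (e ++ [anchorItem i]))).IsNormalized ∧
      (HKPCode.decode a b (outCode L D (e ++ [anchorItem i]))).StackingFree := by
  obtain ⟨-, hGH, htf, hcs⟩ := hc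
  set f := e ++ [anchorItem i] with hf
  have hlen : (decodeExpr (wreathGen a b) (outExpr f)).length = f.length := by
    simp [decodeExpr, outExpr]
  have hpow' : ∀ x ∈ f, x.pow = true →
      (∃ y, (x.word, some y) ∈ c.1) ∧ σ (evalWord (wreathGen a b) x.word) ≠ 1 := by
    intro x hx hp
    rcases List.mem_append.1 hx with hx | hx
    · exact hpow x hx hp
    · obtain rfl := List.mem_singleton.1 hx
      simp [anchorItem] at hp
  have hconst' : ∀ x ∈ f, x.pow = false → InH (evalWord (wreathGen a b) x.word) := by
    intro x hx hp
    rcases List.mem_append.1 hx with hx | hx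
    · exact hconst x hx hp
    · obtain rfl := List.mem_singleton.1 hx
      exact ⟨1, by simp [anchorItem, Item.word]⟩
  have horig : ∀ α ∈ decodeExpr (wreathGen a b) (outExpr f), α.IsPower →
      (∃ y, (α.1, some y) ∈ decodeExpr (wreathGen a b) c.1) ∧ σ α.1 ≠ 1 := by
    intro α hα hp
    obtain ⟨x, hx, k, rfl⟩ := mem_decodeExpr_outExpr a b hα
    rcases h : x.pow with _ | _
    · simp [Atom.IsPower, h] at hp
    · obtain ⟨⟨y, hy⟩, hne⟩ := hpow' x hx h
      exact ⟨⟨y, List.mem_map.2 ⟨_, hy, rfl⟩⟩, hne⟩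
  have horigc : ∀ α ∈ decodeExpr (wreathGen a b) (outExpr f), ¬ α.IsPower → InH α.1 := by
    intro α hα hp
    obtain ⟨x, hx, k, rfl⟩ := mem_decodeExpr_outExpr a b hα
    rcases h : x.pow with _ | _
    · exact hconst' x hx h
    · simp [Atom.IsPower, h] at hp
  have hInGH : ∀ g y, (g, some y) ∈ decodeExpr (wreathGen a b) c.1 → σ g ≠ 1 → InGH g := by
    intro g y hy hne
    obtain ⟨E', g', hE, h⟩ := hGH
    change decodeExpr (wreathGen a b) c.1 = _ at hE
    rw [hE] at hy
    rcases List.mem_append.1 hy with hy | hy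
    · exact ((h _ hy).1 rfl).resolve_left hne
    · simp at hy
  have hsnoc : decodeExpr (wreathGen a b) (outExpr f) =
      decodeExpr (wreathGen a b) (outExpr e) ++ [(1, none)] := by
    rw [hf, outExpr_eq, outExpr_eq, List.mapIdx_concat]
    simp [decodeExpr, anchorItem, Item.word, Item.pow]
  refine ⟨⟨⟨?_, ?_, ?_⟩, ?_, ?_, ?_⟩, ?_⟩
  · show ((decodeExpr (wreathGen a b) (outExpr f)).filterMap Prod.snd).Nodup
    rw [decodeExpr, outExpr, List.map_map, List.filterMap_map]
    refine List.nodup_range.filterMap ?_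
    intro k l z hk hl
    have key : ∀ {k}, z ∈ (Prod.snd ∘ (fun α : Atom (Word (Fin m ⊕ Fin n)) =>
        (evalWord (wreathGen a b) α.1, α.2)) ∘ fun k => (f[k]?).elim (([], none) : Atom _) fun x =>
          (x.word, bif x.pow then some k else none)) k → z = k := by
      intro k hk
      rcases h : f[k]? with _ | x
      · simp [h] at hk
      · rcases h' : x.pow <;> simp [h, h'] at hk
        exact hk.symm
    rw [← key hk, ← key hl]
  · intro p hp
    obtain ⟨x, y, hx, hy, -⟩ := mem_pairsWhere.1 hp
    show _ ≤ (decodeExpr (wreathGen a b) (outExpr f)).length ∧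
      _ ≤ (decodeExpr (wreathGen a b) (outExpr f)).length
    rw [hlen]
    exact ⟨(List.getElem?_eq_some_iff.1 hx).1.le, (List.getElem?_eq_some_iff.1 hy).1.le⟩
  · intro p hp
    obtain ⟨q, hq, rfl⟩ := List.mem_map.1 hp
    obtain ⟨x, y, hx, hy, -⟩ := mem_pairsWhere.1 hq
    show _ ∈ Set.Icc 1 (decodeExpr (wreathGen a b) (outExpr f)).length ∧
      _ ∈ Set.Icc 1 (decodeExpr (wreathGen a b) (outExpr f)).length
    rw [hlen]
    exact ⟨⟨Nat.le_add_left _ _, (List.getElem?_eq_some_iff.1 hx).1⟩,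
      ⟨Nat.le_add_left _ _, (List.getElem?_eq_some_iff.1 hy).1⟩⟩
  · refine ⟨_, 1, hsnoc, fun α hα => ?_⟩
    have hα' : α ∈ decodeExpr (wreathGen a b) (outExpr f) := by
      rw [hsnoc]; exact List.mem_append_left _ hα
    refine ⟨fun hp => ?_, horigc α hα'⟩
    obtain ⟨⟨y, hy⟩, hne⟩ := horig α hα' hp
    exact Or.inr (hInGH _ y hy hne)
  · intro α hα hp
    obtain ⟨⟨y, hy⟩, -⟩ := horig α hα hp
    have h := htf _ hy rfl
    exact h
  · intro α hα β hβ hp hq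
    obtain ⟨⟨y, hy⟩, -⟩ := horig α hα hp
    obtain ⟨⟨z, hz⟩, -⟩ := horig β hβ hq
    have h := hcs _ hy _ hz rfl rfl
    exact h
  · rintro j ⟨α, hj, hα, h⟩
    change (decodeExpr (wreathGen a b) (outExpr f))[j - 1]? = _ at hα
    rcases h with ⟨hp, h1⟩ | ⟨hj', hH⟩
    · exact (horig α (List.mem_of_getElem? hα) hp).2 h1
    · change j = (decodeExpr (wreathGen a b) (outExpr f)).length at hj'
      rw [hj', hsnoc, List.length_append, List.length_singleton, Nat.add_sub_cancel,
        List.getElem?_concat_length, Option.some.injEq] at hα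
      exact hH ⟨1, by rw [← hα]; simp [Atom.base]⟩

end Output

/-! ### Refining a single atom -/

section Blocks

variable {G H : Type*} [Group G] [Group H] {m n : ℕ} {a : Fin m → G} {b : Fin n → H}
  {triv : Word (Fin m ⊕ Fin n) → Bool}

theorem mem_listsOfLength {N k : ℕ} {ℓ : List ℕ} :
    ℓ ∈ listsOfLength N k ↔ ℓ.length = k ∧ ∀ c ∈ ℓ, c < N := by
  induction k generalizing ℓ with
  | zero => simp +contextual [listsOfLength]
  | succ k ih =>
    have h : listsOfLength N (k + 1) =
      (listsOfLength N k).flatMap fun l => (List.range N).map fun c => c :: l := rfl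
    rw [h]
    simp only [List.mem_flatMap, ih, List.mem_map, List.mem_range]
    constructor
    · rintro ⟨l, ⟨rfl, hl⟩, c, hc, rfl⟩
      exact ⟨rfl, by simpa using ⟨hc, hl⟩⟩
    · rintro ⟨h₁, h₂⟩
      rcases ℓ with _ | ⟨c, l⟩
      · simp at h₁
      · exact ⟨l, ⟨by simpa using h₁, fun d hd => h₂ d (List.mem_cons_of_mem _ hd)⟩, c,
          h₂ c List.mem_cons_self, rfl⟩

@[simp] theorem step_anchorItem (i k : ℕ) : step b ((anchorItem i : Item m n), k) = 1 := rfl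

@[simp] theorem step_pointItem (i k : ℕ) : step b ((pointItem i : Item m n), k) = 1 := rfl

theorem fullVal_anchorItem (η : ℕ → ℕ) (i k : ℕ) :
    fullVal a b η (anchorItem i, k) = 1 := by
  simp [fullVal, markVal, anchorItem, bareVal, Item.mark, Item.pow, Item.word]

theorem fullVal_pointItem (η : ℕ → ℕ) (i k : ℕ) :
    fullVal a b η (pointItem i, k) = 1 := by
  simp [fullVal, markVal, pointItem, bareVal, Item.mark, Item.pow, Item.word]

/-- The run `B` refines the atom `α` with number `i`. -/
def Refines (a : Fin m → G) (b : Fin n → H) (η ν : ℕ → ℕ) (i : ℕ) (α : Atom (Wreath G H))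
    (B : List (Item m n × ℕ)) : Prop :=
  (B.map (fullVal a b η)).prod = atomVal ν α ∧
  (∀ p j y, (∃ Y ∈ place (step b) p B, Y.2.1.anchor = some j ∧ Y.1 = y) ↔ j = i ∧ y = p) ∧
  ∀ p j y, (∃ Y ∈ place (step b) p B, Y.2.1.tag = some j ∧ y ∈ itemSupp b Y) ↔
    j = i + 1 ∧ y ∈ atomSupp ν p α

/-- The marks have the classes given by `κ`, and powers avoid the points that have a class. -/
def Obeys (b : Fin n → H) (κ : H → Option ℕ) (P : List (H × Item m n × ℕ)) : Prop :=
  ∀ Y ∈ P, (∀ q, Y.2.1.mark = some q → κ Y.1 = some q.1) ∧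
    (Y.2.1.pow = true → ∀ y ∈ itemSupp b Y, κ y = none)

theorem refines_anchor (η ν : ℕ → ℕ) (i k x : ℕ) (g : Wreath G H) (hx : ν x = 0) :
    Refines a b η ν i (g, some x) [((anchorItem i : Item m n), k)] := by
  refine ⟨?_, fun p j y => ?_, fun p j y => ?_⟩
  · simp [fullVal_anchorItem, atomVal, hx]
  · simp [place, anchorItem, Item.anchor, eq_comm]
  · simp [place, anchorItem, Item.tag, atomSupp, hx]

section Letters

variable (ht : ∀ w, triv w = true ↔ σ (evalWord (wreathGen a b) w) = 1)

theorem letterItems_props {w : Word (Fin m ⊕ Fin n)} {x : Option ℕ} {ℓ : List ℕ} {y : Item m n}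
    (hy : y ∈ letterItems triv w x ℓ) : y.pow = false ∧ y.tag = none ∧ y.anchor = none ∧
      InH (evalWord (wreathGen a b) y.word) := by
  obtain ⟨k, -, rfl⟩ := List.mem_map.1 hy
  exact ⟨rfl, rfl, rfl, _, evalWord_hPart a b _⟩

include ht in
theorem prod_letterItems (η : ℕ → ℕ) {w : Word (Fin m ⊕ Fin n)} {x : Option ℕ} {ℓ : List ℕ}
    {B : List (Item m n × ℕ)} (hB : B.map Prod.fst = letterItems triv w x ℓ) {u : Wreath G H}
    (hσ : σ u = σ (evalWord (wreathGen a b) w))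
    (hτ : ∀ y, τ u y = τ (evalWord (wreathGen a b) w) y ^ x.elim 1 fun z => η z + 1) :
    (B.map (fullVal a b η)).prod = u := by
  have h : B.map (fullVal a b η) = (B.map Prod.fst).map fun y => fullVal a b η (y, 0) := by
    rw [List.map_map]
    refine List.map_congr_left fun r hr => ?_
    have hp : r.1.pow = false := (letterItems_props (a := a) (b := b)
      (hB ▸ List.mem_map_of_mem hr)).1
    simp [fullVal, bareVal, hp]
  rw [h, hB, letterItems, List.map_map, ← prod_firstVisits ht w _ hσ hτ]
  congr 1
  refine List.map_congr_left fun k _ => ?_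
  simp [fullVal, bareVal, letterItem, markVal, Item.mark, Item.pow, Item.word, evalWord_hPart]

include ht in
theorem refines_letters {η ν : ℕ → ℕ} (i : ℕ) {w : Word (Fin m ⊕ Fin n)} {x : Option ℕ}
    (hx : ∀ y, x = some y → σ (evalWord (wreathGen a b) w) = 1 ∧ ν y = η y + 1) {ℓ : List ℕ}
    {B : List (Item m n × ℕ)}
    (hB : B.map Prod.fst = anchorItem i :: pointItem i :: letterItems triv w x ℓ) :
    Refines a b η ν i (evalWord (wreathGen a b) w, x) B := by
  rcases B with _ | ⟨⟨_, k⟩, _ | ⟨⟨_, l⟩, B⟩⟩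
  · simp at hB
  · simp at hB
  simp only [List.map_cons, List.cons.injEq] at hB
  obtain ⟨rfl, rfl, hB⟩ := hB
  have hmem : ∀ {p} {Y : H × Item m n × ℕ}, Y ∈ place (step b) p B →
      Y.2.1.tag = none ∧ Y.2.1.anchor = none := by
    intro p Y hY
    have h := letterItems_props (a := a) (b := b)
      (hB ▸ List.mem_map_of_mem (mem_of_mem_place _ hY))
    exact ⟨h.2.1, h.2.2.1⟩
  have hplace : ∀ p, place (step b) p ((anchorItem i, k) :: (pointItem i, l) :: B) =
      (p, anchorItem i, k) :: (p, pointItem i, l) :: place (step b) p B := by simp [place]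
  refine ⟨?_, fun p j y => ?_, fun p j y => ?_⟩
  · rw [List.map_cons, List.map_cons, List.prod_cons, List.prod_cons, fullVal_anchorItem,
      fullVal_pointItem, one_mul, one_mul]
    refine prod_letterItems ht η hB ?_ ?_
    · rcases x with _ | y
      · rfl
      · simp [atomVal, (hx y rfl).1]
    · rcases x with _ | y
      · simp [atomVal]
      · intro z
        simp [atomVal, (hx y rfl).2, τ_pow (hx y rfl).1]
  · rw [hplace]
    constructor
    · rintro ⟨Y, hY, h₁, rfl⟩
      rcases List.mem_cons.1 hY with rfl | hY
      · exact ⟨(Option.some.inj h₁).symm, rfl⟩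
      · rcases List.mem_cons.1 hY with rfl | hY
        · cases h₁
        · rw [(hmem hY).2] at h₁; cases h₁
    · rintro ⟨rfl, rfl⟩
      exact ⟨_, List.mem_cons_self, rfl, rfl⟩
  · have hsupp : atomSupp ν p (evalWord (wreathGen a b) w, x) = {p} := by
      rcases x with _ | z
      · rfl
      · ext q
        simp [atomSupp, (hx z rfl).1, (hx z rfl).2]
        exact fun _ => ⟨0, by simp⟩
    rw [hplace, hsupp]
    constructor
    · rintro ⟨Y, hY, h₁, h₂⟩
      rcases List.mem_cons.1 hY with rfl | hY
      · cases h₁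
      · rcases List.mem_cons.1 hY with rfl | hY
        · exact ⟨(Option.some.inj h₁).symm, h₂⟩
        · rw [(hmem hY).1] at h₁; cases h₁
    · rintro ⟨rfl, h⟩
      exact ⟨_, List.mem_cons_of_mem _ List.mem_cons_self, rfl, h⟩

theorem exists_letters_obey {κ : H → Option ℕ} {N : ℕ} (hN : ∀ y c, κ y = some c → c < N)
    (w : Word (Fin m ⊕ Fin n)) (x : Option ℕ) (p : H)
    (hκ : ∀ k < w.length, κ (p * σ (evalWord (wreathGen a b) (w.take k))) ≠ none) (i : ℕ) :
    ∃ ℓ ∈ listsOfLength N w.length, ∃ B : List (Item m n × ℕ),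
      B.map Prod.fst = anchorItem i :: pointItem i :: letterItems triv w x ℓ ∧
      Obeys b κ (place (step b) p B) := by
  set κ' : ℕ → ℕ := fun k => (κ (p * σ (evalWord (wreathGen a b) (w.take k)))).getD 0 with hκ'
  have hκκ : ∀ k < w.length,
      κ (p * σ (evalWord (wreathGen a b) (w.take k))) = some (κ' k) := by
    intro k hk
    obtain ⟨c, hc⟩ := Option.ne_none_iff_exists'.1 (hκ k hk)
    simp [hκ', hc]
  set ℓ := (List.range w.length).map κ' with hℓ
  set B : List (Item m n × ℕ) := (letterItems triv w x ℓ).map fun y => (y, 0) with hB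
  refine ⟨ℓ, mem_listsOfLength.2 ⟨by simp [hℓ], ?_⟩,
    (anchorItem i, 0) :: (pointItem i, 0) :: B, ?_, ?_⟩
  · intro c hc
    obtain ⟨k, hk, rfl⟩ := List.mem_map.1 hc
    exact hN _ _ (hκκ k (List.mem_range.1 hk))
  · simp [hB, Function.comp_def]
  · have hplace : place (step b) p ((anchorItem i, 0) :: (pointItem i, 0) :: B) =
      (p, anchorItem i, 0) :: (p, pointItem i, 0) :: place (step b) p B := by simp [place]
    rw [hplace]
    intro Y hY
    rcases List.mem_cons.1 hY with rfl | hY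
    · exact ⟨fun q hq => (Option.some_ne_none _ hq.symm).elim, fun h => (Bool.false_ne_true h).elim⟩
    rcases List.mem_cons.1 hY with rfl | hY
    · exact ⟨fun q hq => (Option.some_ne_none _ hq.symm).elim, fun h => (Bool.false_ne_true h).elim⟩
    obtain ⟨k, hk, hkp⟩ := (mem_place_iff _).1 hY
    have hkw : k < w.length := by
      have := (List.getElem?_eq_some_iff.1 hk).1
      simpa [hB, letterItems] using this
    have hY2 : Y.2 = (letterItem triv w x k (κ' k), 0) := by
      have : B[k]? = some (letterItem triv w x k (κ' k), 0) := by
        simp [hB, letterItems, hkw, hℓ]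
      rw [this] at hk
      exact (Option.some.inj hk).symm
    have hY1 : Y.1 = p * σ (evalWord (wreathGen a b) (w.take k)) := by
      rw [hkp, ← prod_letterAt _ _ hkw.le]
      congr 1
      have h : ∀ l : List ℕ, σ ((l.map fun j =>
          evalWord (wreathGen a b) (letterAt w j)).prod) =
          (l.map fun j => σ (evalWord (wreathGen a b) (letterAt w j))).prod := by
        intro l
        induction l with
        | nil => rfl
        | cons j l ih => simp [ih]
      rw [h, hB, letterItems, List.map_map, ← List.map_take, List.take_range,
        min_eq_left hkw.le, List.map_map]
      congr 1
      refine List.map_congr_left fun j _ => ?_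
      rw [Function.comp_apply, ← σ_bareVal a b]
      simp [bareVal, letterItem, Item.pow, Item.word, evalWord_hPart]
    rw [hY2, hY1]
    refine ⟨fun q hq => ?_, fun h => (Bool.false_ne_true h).elim⟩
    obtain rfl := Option.some.inj hq
    exact hκκ k hkw

end Letters

section Powers

variable (ht : ∀ w, triv w = true ↔ σ (evalWord (wreathGen a b) w) = 1)

/-- The number of steps made by the pieces of a power. -/
def stepCount (B : List (Item m n × ℕ)) : ℕ := (B.map fun r => bif r.1.pow then r.2 else 1).sum

theorem mem_powerItems {i : ℕ} {w : Word (Fin m ⊕ Fin n)} {ℓ : List ℕ} {y : Item m n}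
    (hy : y ∈ powerItems triv i w ℓ) : y = powerItem i w ∨ ∃ c, y = visitItem triv i w c := by
  rcases List.mem_cons.1 hy with rfl | hy
  · exact Or.inl rfl
  · obtain ⟨c, -, hy⟩ := List.mem_flatMap.1 hy
    simp only [List.mem_cons, List.not_mem_nil, or_false] at hy
    rcases hy with rfl | rfl
    exacts [Or.inr ⟨c, rfl⟩, Or.inl rfl]

theorem step_powerItem (i k : ℕ) (w : Word (Fin m ⊕ Fin n)) :
    step b (powerItem i w, k) = σ (evalWord (wreathGen a b) w) ^ k := by
  rw [σ_evalWord]; rfl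

theorem step_visitItem (i c k : ℕ) (w : Word (Fin m ⊕ Fin n)) :
    step b (visitItem triv i w c, k) = σ (evalWord (wreathGen a b) w) := by
  rw [← σ_bareVal a b]
  simp [bareVal, visitItem, Item.pow, Item.word, evalWord_hPart]

theorem itemSupp_powerItem (i k : ℕ) (w : Word (Fin m ⊕ Fin n)) (p : H) :
    itemSupp b (p, powerItem i w, k) =
      {y | ∃ t < k, y = p * σ (evalWord (wreathGen a b) w) ^ t} := by
  rw [σ_evalWord]; rfl

include ht in
theorem prod_powerItems (η : ℕ → ℕ) {i : ℕ} {w : Word (Fin m ⊕ Fin n)}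
    (hw : InGH (evalWord (wreathGen a b) w)) {B : List (Item m n × ℕ)}
    (hB : ∀ r ∈ B, r.1 = powerItem i w ∨ ∃ c, r.1 = visitItem triv i w c) :
    (B.map (fullVal a b η)).prod = evalWord (wreathGen a b) w ^ stepCount B ∧
    ∀ p j y, (∃ Y ∈ place (step b) p B, Y.2.1.tag = some j ∧ y ∈ itemSupp b Y) ↔
      j = i + 1 ∧ ∃ t < stepCount B, y = p * σ (evalWord (wreathGen a b) w) ^ t := by
  induction B with
  | nil => simp [stepCount, place]
  | cons r B ih =>
    obtain ⟨ih₁, ih₂⟩ := ih fun r hr => hB r (List.mem_cons_of_mem _ hr)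
    have hr : ∃ k, stepCount (r :: B) = k + stepCount B ∧
        fullVal a b η r = evalWord (wreathGen a b) w ^ k ∧
        step b r = σ (evalWord (wreathGen a b) w) ^ k ∧ r.1.tag = some (i + 1) ∧
        ∀ p y, y ∈ itemSupp b (p, r) ↔
          ∃ t < k, y = p * σ (evalWord (wreathGen a b) w) ^ t := by
      obtain ⟨x, k⟩ := r
      rcases hB _ List.mem_cons_self with h | ⟨c, h⟩
      · change x = _ at h
        subst h
        refine ⟨k, by simp [stepCount, powerItem, Item.pow], ?_, step_powerItem i k w, rfl, ?_⟩
        · simp [fullVal, markVal, bareVal, powerItem, Item.pow, Item.word, Item.mark]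
        · intro p y
          rw [itemSupp_powerItem (a := a)]
          rfl
      · change x = _ at h
        subst h
        refine ⟨1, by simp [stepCount, visitItem, Item.pow], ?_, ?_, rfl, ?_⟩
        · rw [pow_one, hw.eq]
          simp [fullVal, markVal, bareVal, visitItem, Item.pow, Item.word, Item.mark,
            evalWord_hPart, evalWord_lampWord ht]
        · rw [step_visitItem (a := a), pow_one]
        · intro p y
          simp [itemSupp, visitItem, Item.pow]
    obtain ⟨k, hk, hv, hs, htag, hsupp⟩ := hr
    refine ⟨?_, fun p j y => ?_⟩
    · rw [List.map_cons, List.prod_cons, ih₁, hv, hk, pow_add]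
    · have ih₃ := ih₂ (p * step b r) j y
      constructor
      · rintro ⟨Y, hY, h₁, h₂⟩
        rcases List.mem_cons.1 hY with rfl | hY
        · obtain ⟨t, ht, rfl⟩ := (hsupp _ _).1 h₂
          rw [htag] at h₁
          exact ⟨(Option.some.inj h₁).symm, t, by omega, rfl⟩
        · obtain ⟨rfl, t, ht, rfl⟩ := ih₃.1 ⟨Y, hY, h₁, h₂⟩
          exact ⟨rfl, k + t, by omega, by rw [hs, pow_add, mul_assoc]⟩
      · rintro ⟨rfl, t, ht, rfl⟩
        by_cases htk : t < k
        · exact ⟨_, List.mem_cons_self, htag, (hsupp _ _).2 ⟨t, htk, rfl⟩⟩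
        · obtain ⟨Y, hY, h⟩ := ih₃.2 ⟨rfl, t - k, by omega, by
            rw [hs, mul_assoc, ← pow_add]; congr 2; omega⟩
          exact ⟨Y, List.mem_cons_of_mem _ hY, h⟩

include ht in
theorem refines_powers {η ν : ℕ → ℕ} {i x : ℕ} {w : Word (Fin m ⊕ Fin n)}
    (hw : InGH (evalWord (wreathGen a b) w)) {ℓ : List ℕ} {B : List (Item m n × ℕ)} {k : ℕ}
    (hB : B.map Prod.fst = powerItems triv i w ℓ) (hx : ν x = stepCount B) :
    Refines a b η ν i (evalWord (wreathGen a b) w, some x) ((anchorItem i, k) :: B) := by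
  have hmem : ∀ r ∈ B, r.1 = powerItem i w ∨ ∃ c, r.1 = visitItem triv i w c :=
    fun r hr => mem_powerItems (hB ▸ List.mem_map_of_mem hr)
  obtain ⟨h₁, h₂⟩ := prod_powerItems ht η hw hmem
  have hplace : ∀ p, place (step b) p ((anchorItem i, k) :: B) =
      (p, anchorItem i, k) :: place (step b) p B := by simp [place]
  refine ⟨?_, fun p j y => ?_, fun p j y => ?_⟩
  · rw [List.map_cons, List.prod_cons, fullVal_anchorItem, one_mul, h₁, atomVal, hx]
  · rw [hplace]
    constructor
    · rintro ⟨Y, hY, h₁, rfl⟩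
      rcases List.mem_cons.1 hY with rfl | hY
      · exact ⟨(Option.some.inj h₁).symm, rfl⟩
      · rcases hmem _ (mem_of_mem_place _ hY) with h | ⟨c, h⟩ <;> rw [h] at h₁ <;> cases h₁
    · rintro ⟨rfl, rfl⟩
      exact ⟨_, List.mem_cons_self, rfl, rfl⟩
  · rw [hplace, atomSupp, Option.elim_some, hx]
    refine Iff.trans ?_ (h₂ p j y)
    constructor
    · rintro ⟨Y, hY, h₁, h₂⟩
      rcases List.mem_cons.1 hY with rfl | hY
      · cases h₁
      · exact ⟨Y, hY, h₁, h₂⟩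
    · rintro ⟨Y, hY, h⟩
      exact ⟨Y, List.mem_cons_of_mem _ hY, h⟩

theorem exists_powers_obey {κ : H → Option ℕ}
    (hinj : ∀ y z c, κ y = some c → κ z = some c → y = z) (i : ℕ)
    {w : Word (Fin m ⊕ Fin n)} (hw : ¬ IsOfFinOrder (σ (evalWord (wreathGen a b) w)))
    (e : ℕ) (p : H) : ∃ (ℓ : List ℕ) (B : List (Item m n × ℕ)),
      B.map Prod.fst = powerItems triv i w ℓ ∧ stepCount B = e ∧
      Obeys b κ (place (step b) p B) ∧ ℓ.Nodup ∧
      ∀ c ∈ ℓ, ∃ t < e, κ (p * σ (evalWord (wreathGen a b) w) ^ t) = some c := by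
  set h := σ (evalWord (wreathGen a b) w) with hh
  induction e generalizing p with
  | zero =>
    refine ⟨[], [(powerItem i w, 0)], rfl, rfl, ?_, List.nodup_nil, by simp⟩
    intro Y hY
    obtain rfl := List.mem_singleton.1 hY
    refine ⟨fun q hq => (Option.some_ne_none _ hq.symm).elim, fun _ y hy => ?_⟩
    rw [itemSupp_powerItem (a := a)] at hy
    obtain ⟨t, ht, -⟩ := hy
    omega
  | succ e ih =>
    obtain ⟨ℓ, B, hB, he, hobey, hnd, hc⟩ := ih (p * h)
    rcases hp : κ p with _ | c
    · rcases B with _ | ⟨⟨x, k⟩, B⟩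
      · simp [powerItems] at hB
      rw [powerItems, List.map_cons, List.cons.injEq] at hB
      obtain ⟨hx, hB⟩ := hB
      change x = _ at hx
      subst hx
      refine ⟨ℓ, (powerItem i w, k + 1) :: B, by simp [powerItems, hB], ?_, ?_, hnd, ?_⟩
      · simp [stepCount, powerItem, Item.pow] at he ⊢
        omega
      · intro Y hY
        rcases List.mem_cons.1 hY with rfl | hY
        · refine ⟨fun q hq => (Option.some_ne_none _ hq.symm).elim, fun _ y hy => ?_⟩
          rw [itemSupp_powerItem (a := a)] at hy
          obtain ⟨_ | t, ht, rfl⟩ := hy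
          · simpa using hp
          · refine (hobey _ List.mem_cons_self).2 rfl _ ?_
            rw [itemSupp_powerItem (a := a)]
            exact ⟨t, by omega, by rw [pow_succ', ← hh]; simp only [mul_assoc]⟩
        · refine hobey Y (List.mem_cons_of_mem _ ?_)
          rw [step_powerItem (a := a)] at hY ⊢
          rwa [pow_succ', ← mul_assoc] at hY
      · intro c hcℓ
        obtain ⟨t, ht, hκ⟩ := hc c hcℓ
        exact ⟨t + 1, by omega, by rw [pow_succ', ← mul_assoc]; exact hκ⟩
    · refine ⟨c :: ℓ, (powerItem i w, 0) :: (visitItem triv i w c, 0) :: B, ?_, ?_, ?_, ?_, ?_⟩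
      · simp [powerItems, hB]
      · simp [stepCount, powerItem, visitItem, Item.pow] at he ⊢
        omega
      · intro Y hY
        rcases List.mem_cons.1 hY with rfl | hY
        · refine ⟨fun q hq => (Option.some_ne_none _ hq.symm).elim, fun _ y hy => ?_⟩
          rw [itemSupp_powerItem (a := a)] at hy
          obtain ⟨t, ht, -⟩ := hy
          omega
        rw [step_powerItem (a := a), pow_zero, mul_one] at hY
        rcases List.mem_cons.1 hY with rfl | hY
        · refine ⟨fun q hq => ?_, fun h => (Bool.false_ne_true h).elim⟩
          obtain rfl := Option.some.inj hq
          exact hp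
        · rw [step_visitItem (a := a)] at hY
          exact hobey Y hY
      · refine List.nodup_cons.2 ⟨fun hcℓ => ?_, hnd⟩
        obtain ⟨t, -, hκ⟩ := hc c hcℓ
        have := hinj _ _ _ hp hκ
        rw [mul_assoc, ← pow_succ', left_eq_mul] at this
        exact hw (isOfFinOrder_iff_pow_eq_one.2 ⟨t + 1, t.succ_pos, this⟩)
      · intro d hd
        rcases List.mem_cons.1 hd with rfl | hd
        · exact ⟨0, e.succ_pos, by simpa using hp⟩
        · obtain ⟨t, ht, hκ⟩ := hc d hd
          exact ⟨t + 1, by omega, by rw [pow_succ', ← mul_assoc]; exact hκ⟩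

end Powers

end Blocks

section Assembly

variable {G H : Type*} [Group G] [Group H] {m n : ℕ} {a : Fin m → G} {b : Fin n → H}
  {triv : Word (Fin m ⊕ Fin n) → Bool}

theorem refines_of_mem_blocks (ht : ∀ w, triv w = true ↔ σ (evalWord (wreathGen a b) w) = 1)
    (η : ℕ → ℕ) {N i : ℕ} {α : Atom (Word (Fin m ⊕ Fin n))}
    (hα : ∀ x, α.2 = some x → σ (evalWord (wreathGen a b) α.1) = 1 ∨
      InGH (evalWord (wreathGen a b) α.1))
    {B : List (Item m n × ℕ)} (hB : B.map Prod.fst ∈ blocks triv N i α) :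
    ∃ e, ∀ ν : ℕ → ℕ, (∀ x, α.2 = some x → ν x = e) →
      Refines a b η ν i (evalWord (wreathGen a b) α.1, α.2) B := by
  obtain ⟨w, _ | x⟩ := α
  · obtain ⟨ℓ, -, hℓ⟩ := List.mem_map.1 hB
    exact ⟨0, fun ν _ => refines_letters ht i (by simp) hℓ.symm⟩
  · rcases h : triv w with _ | _
    · simp only [blocks, Option.elim_some, h, cond_false] at hB
      obtain ⟨ℓ, -, hℓ⟩ := List.mem_map.1 hB
      rcases B with _ | ⟨⟨_, k⟩, B⟩
      · simp at hℓ
      simp only [List.map_cons, List.cons.injEq] at hℓ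
      obtain ⟨rfl, hℓ⟩ := hℓ
      have hw : InGH (evalWord (wreathGen a b) w) := (hα x rfl).resolve_left fun h1 => by
        rw [(ht w).2 h1] at h; cases h
      exact ⟨stepCount B, fun ν hν => refines_powers ht hw hℓ.symm (hν x rfl)⟩
    · have h1 : σ (evalWord (wreathGen a b) w) = 1 := (ht w).1 h
      simp only [blocks, Option.elim_some, h, cond_true] at hB
      rcases List.mem_cons.1 hB with hB | hB
      · refine ⟨0, fun ν hν => ?_⟩
        rcases B with _ | ⟨⟨_, k⟩, _ | ⟨_, B⟩⟩
        · simp at hB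
        · simp only [List.map_cons, List.cons.injEq] at hB
          obtain ⟨rfl, -⟩ := hB
          exact refines_anchor η ν i k x _ (hν x rfl)
        · simp at hB
      · obtain ⟨ℓ, -, hℓ⟩ := List.mem_map.1 hB
        refine ⟨η x + 1, fun ν hν => refines_letters ht i ?_ hℓ.symm⟩
        rintro y hy
        obtain rfl := Option.some.inj hy
        exact ⟨h1, hν x rfl⟩

theorem exists_block (ht : ∀ w, triv w = true ↔ σ (evalWord (wreathGen a b) w) = 1)
    {η ν : ℕ → ℕ} (hη : ∀ x, ν x ≠ 0 → ν x = η x + 1) {κ : H → Option ℕ} {N : ℕ}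
    (hinj : ∀ y z c, κ y = some c → κ z = some c → y = z)
    (hN : ∀ y c, κ y = some c → c < N) (i : ℕ) {α : Atom (Word (Fin m ⊕ Fin n))}
    (hα : ∀ x, α.2 = some x → σ (evalWord (wreathGen a b) α.1) = 1 ∨
      InGH (evalWord (wreathGen a b) α.1))
    (hα' : ∀ x, α.2 = some x → σ (evalWord (wreathGen a b) α.1) = 1 ∨
      ¬ IsOfFinOrder (σ (evalWord (wreathGen a b) α.1))) (p : H)
    (hκ : ∀ k < α.1.length, κ (p * σ (evalWord (wreathGen a b) (α.1.take k))) ≠ none) :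
    ∃ B : List (Item m n × ℕ), B.map Prod.fst ∈ blocks triv N i α ∧
      Refines a b η ν i (evalWord (wreathGen a b) α.1, α.2) B ∧
      Obeys b κ (place (step b) p B) := by
  obtain ⟨w, _ | x⟩ := α
  · obtain ⟨ℓ, hℓ, B, hB, hobey⟩ := exists_letters_obey (triv := triv) hN w none p hκ i
    exact ⟨B, List.mem_map.2 ⟨ℓ, hℓ, hB.symm⟩, refines_letters ht i (by simp) hB, hobey⟩
  · rcases h : triv w with _ | _
    · have h1 : σ (evalWord (wreathGen a b) w) ≠ 1 := fun h1 => by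
        rw [(ht w).2 h1] at h; cases h
      obtain ⟨ℓ, B, hB, he, hobey, hnd, hc⟩ := exists_powers_obey (triv := triv) hinj i
        ((hα' x rfl).resolve_left h1) (ν x) p
      refine ⟨(anchorItem i, 0) :: B, ?_,
        refines_powers ht ((hα x rfl).resolve_left h1) hB he.symm, ?_⟩
      · simp only [blocks, Option.elim_some, h, cond_false]
        refine List.mem_map.2 ⟨ℓ, List.mem_flatMap.2 ⟨ℓ.length, ?_, ?_⟩, by simp [hB]⟩
        · have hsub : ℓ ⊆ List.range N := fun c hcℓ => by
            obtain ⟨t, -, hκ⟩ := hc c hcℓ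
            exact List.mem_range.2 (hN _ _ hκ)
          have := (hnd.subperm hsub).length_le
          rw [List.length_range] at this
          exact List.mem_range.2 (Nat.lt_succ_of_le this)
        · refine mem_listsOfLength.2 ⟨rfl, fun c hcℓ => ?_⟩
          obtain ⟨t, -, hκ⟩ := hc c hcℓ
          exact hN _ _ hκ
      · intro Y hY
        rcases List.mem_cons.1 hY with rfl | hY
        · exact ⟨fun q hq => (Option.some_ne_none _ hq.symm).elim,
            fun h => (Bool.false_ne_true h).elim⟩
        · rw [step_anchorItem, mul_one] at hY
          exact hobey Y hY
    · have h1 : σ (evalWord (wreathGen a b) w) = 1 := (ht w).1 h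
      by_cases hx : ν x = 0
      · refine ⟨[(anchorItem i, 0)], ?_, refines_anchor η ν i 0 x _ hx, ?_⟩
        · simp [blocks, h]
        · intro Y hY
          obtain rfl := List.mem_singleton.1 hY
          exact ⟨fun q hq => (Option.some_ne_none _ hq.symm).elim,
            fun h => (Bool.false_ne_true h).elim⟩
      · obtain ⟨ℓ, hℓ, B, hB, hobey⟩ := exists_letters_obey (triv := triv) hN w (some x) p hκ i
        refine ⟨B, ?_, refines_letters ht i ?_ hB, hobey⟩
        · simp only [blocks, Option.elim_some, h, cond_true]
          exact List.mem_cons_of_mem _ (List.mem_map.2 ⟨ℓ, hℓ, hB.symm⟩)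
        · rintro y hy
          obtain rfl := Option.some.inj hy
          exact ⟨h1, hη x hx⟩

theorem blocks_props (ht : ∀ w, triv w = true ↔ σ (evalWord (wreathGen a b) w) = 1)
    {N i : ℕ} {α : Atom (Word (Fin m ⊕ Fin n))} {e : List (Item m n)}
    (he : e ∈ blocks triv N i α) {x : Item m n} (hx : x ∈ e) :
    (x.pow = true → x.mark = none ∧ x.word = α.1 ∧ (∃ y, α.2 = some y) ∧
      σ (evalWord (wreathGen a b) α.1) ≠ 1) ∧
    (x.pow = false → InH (evalWord (wreathGen a b) x.word)) := by
  have h0 : ∀ (y : Item m n), y.pow = false → y.word = [] →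
      (y.pow = true → y.mark = none ∧ y.word = α.1 ∧ (∃ z, α.2 = some z) ∧
        σ (evalWord (wreathGen a b) α.1) ≠ 1) ∧
      (y.pow = false → InH (evalWord (wreathGen a b) y.word)) := by
    intro y hy hw
    refine ⟨fun h => ?_, fun _ => ⟨1, by rw [hw]; simp⟩⟩
    rw [hy] at h; cases h
  have hl : ∀ {w : Word (Fin m ⊕ Fin n)} {z ℓ},
      x ∈ anchorItem i :: pointItem i :: letterItems triv w z ℓ →
      (x.pow = true → x.mark = none ∧ x.word = α.1 ∧ (∃ y, α.2 = some y) ∧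
        σ (evalWord (wreathGen a b) α.1) ≠ 1) ∧
      (x.pow = false → InH (evalWord (wreathGen a b) x.word)) := by
    intro w z ℓ hx
    rcases List.mem_cons.1 hx with rfl | hx
    · exact h0 _ rfl rfl
    rcases List.mem_cons.1 hx with rfl | hx
    · exact h0 _ rfl rfl
    have := letterItems_props (a := a) (b := b) hx
    exact ⟨fun h => (by rw [this.1] at h; cases h), fun _ => this.2.2.2⟩
  obtain ⟨w, _ | y⟩ := α
  · obtain ⟨ℓ, -, rfl⟩ := List.mem_map.1 he
    exact hl hx
  · rcases h : triv w with _ | _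
    · simp only [blocks, Option.elim_some, h, cond_false] at he
      obtain ⟨ℓ, -, rfl⟩ := List.mem_map.1 he
      rcases List.mem_cons.1 hx with rfl | hx
      · exact h0 _ rfl rfl
      rcases mem_powerItems hx with rfl | ⟨c, rfl⟩
      · refine ⟨fun _ => ⟨rfl, rfl, ⟨y, rfl⟩, fun h1 => ?_⟩, fun h => by cases h⟩
        rw [(ht w).2 h1] at h; cases h
      · exact ⟨fun h => (by cases h), fun _ => ⟨_, evalWord_hPart a b w⟩⟩
    · simp only [blocks, Option.elim_some, h, cond_true] at he
      rcases List.mem_cons.1 he with rfl | he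
      · obtain rfl := List.mem_singleton.1 hx
        exact h0 _ rfl rfl
      · obtain ⟨ℓ, -, rfl⟩ := List.mem_map.1 he
        exact hl hx

theorem mem_prefixRefinements {N k : ℕ} {E : ExpExpr (Word (Fin m ⊕ Fin n))}
    {R : List (Item m n × ℕ)} : R.map Prod.fst ∈ prefixRefinements triv N E k ↔
      ∃ Bs : ℕ → List (Item m n × ℕ),
        (∀ j < k, ∃ α, E[j]? = some α ∧ (Bs j).map Prod.fst ∈ blocks triv N j α) ∧
        R = (List.range k).flatMap Bs := by
  induction k generalizing R with
  | zero => simp [prefixRefinements]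
  | succ k ih =>
    have h : prefixRefinements triv N E (k + 1) = (prefixRefinements triv N E k).flatMap fun e =>
      ((E[k]?).elim [] (blocks triv N k)).map fun b => e ++ b := rfl
    rw [h]
    constructor
    · intro hR
      obtain ⟨e, he, hR⟩ := List.mem_flatMap.1 hR
      obtain ⟨d, hd, hR⟩ := List.mem_map.1 hR
      obtain ⟨R₁, R₂, rfl, rfl, rfl⟩ := List.map_eq_append_iff.1 hR.symm
      obtain ⟨Bs, hBs, rfl⟩ := ih.1 he
      refine ⟨fun j => if j = k then R₂ else Bs j, fun j hj => ?_, ?_⟩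
      · rcases Nat.lt_succ_iff_lt_or_eq.1 hj with hj | rfl
        · simpa [hj.ne] using hBs j hj
        · rcases hE : E[j]? with _ | α
          · simp [hE] at hd
          · exact ⟨α, rfl, by simpa [hE] using hd⟩
      · rw [List.range_succ, List.flatMap_append]
        congr 1
        · refine List.flatMap_congr fun j hj => ?_
          rw [if_neg (List.mem_range.1 hj).ne]
        · simp
    · rintro ⟨Bs, hBs, rfl⟩
      obtain ⟨α, hα, hB⟩ := hBs k k.lt_succ_self
      refine List.mem_flatMap.2 ⟨((List.range k).flatMap Bs).map Prod.fst,
        ih.2 ⟨Bs, fun j hj => hBs j (hj.trans k.lt_succ_self), rfl⟩, List.mem_map.2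
          ⟨(Bs k).map Prod.fst, by simpa [hα] using hB, ?_⟩⟩
      rw [List.range_succ, List.flatMap_append, List.map_append]
      simp

/-- The run `R` refines the expression `E`. -/
def RefinesExpr (a : Fin m → G) (b : Fin n → H) (η ν : ℕ → ℕ) (E : ExpExpr (Wreath G H))
    (R : List (Item m n × ℕ)) : Prop :=
  (R.map (fullVal a b η)).prod = exprVal ν E ∧
  (∀ j y, (∃ Y ∈ place (step b) 1 R, Y.2.1.anchor = some j ∧ Y.1 = y) ↔
    j ≤ E.length ∧ y = pos ν E j) ∧
  ∀ j y, (∃ Y ∈ place (step b) 1 R, Y.2.1.tag = some j ∧ y ∈ itemSupp b Y) ↔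
    (1 ≤ j ∧ j ≤ E.length) ∧ y ∈ suppSet ν E j

theorem refines_prefix {η ν : ℕ → ℕ} {E : ExpExpr (Wreath G H)}
    {Bs : ℕ → List (Item m n × ℕ)}
    (hBs : ∀ j α, E[j]? = some α → Refines a b η ν j α (Bs j)) {k : ℕ} (hk : k ≤ E.length) :
    (((List.range k).flatMap Bs).map (fullVal a b η)).prod = exprVal ν (E.take k) ∧
    (∀ Y, Y ∈ place (step b) 1 ((List.range k).flatMap Bs) ↔
      ∃ j < k, Y ∈ place (step b) (pos ν E j) (Bs j)) := by
  induction k with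
  | zero => simp [place, exprVal]
  | succ k ih =>
    obtain ⟨ih₁, ih₂⟩ := ih (Nat.le_of_succ_le hk)
    have hE : E[k]? = some E[k] := List.getElem?_eq_getElem hk
    have hlast : (List.range (k + 1)).flatMap Bs = (List.range k).flatMap Bs ++ Bs k := by
      rw [List.range_succ, List.flatMap_append]; simp
    constructor
    · rw [hlast, List.map_append, List.prod_append, ih₁, (hBs k _ hE).1,
        List.take_succ_eq_append_getElem hk, exprVal_append]
      simp [exprVal]
    · intro Y
      rw [hlast, place_append, List.mem_append, ih₂, one_mul, ← prod_σ_fullVal a b η, ih₁]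
      constructor
      · rintro (⟨j, hj, h⟩ | h)
        exacts [⟨j, hj.trans k.lt_succ_self, h⟩, ⟨k, k.lt_succ_self, h⟩]
      · rintro ⟨j, hj, h⟩
        rcases Nat.lt_succ_iff_lt_or_eq.1 hj with hj | rfl
        exacts [Or.inl ⟨j, hj, h⟩, Or.inr h]

theorem refinesExpr_of_blocks {η ν : ℕ → ℕ} {E : ExpExpr (Wreath G H)}
    {Bs : ℕ → List (Item m n × ℕ)}
    (hBs : ∀ j α, E[j]? = some α → Refines a b η ν j α (Bs j)) (k : ℕ) :
    RefinesExpr a b η ν E ((List.range E.length).flatMap Bs ++ [(anchorItem E.length, k)]) ∧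
    ∀ Y ∈ place (step b) 1 ((List.range E.length).flatMap Bs ++ [(anchorItem E.length, k)]),
      (∃ j < E.length, Y ∈ place (step b) (pos ν E j) (Bs j)) ∨
        Y = (pos ν E E.length, anchorItem E.length, k) := by
  obtain ⟨h₁, h₂⟩ := refines_prefix hBs (le_refl E.length)
  have hmem : ∀ Y, Y ∈ place (step b) 1
      ((List.range E.length).flatMap Bs ++ [(anchorItem E.length, k)]) ↔
      (∃ j < E.length, Y ∈ place (step b) (pos ν E j) (Bs j)) ∨
        Y = (pos ν E E.length, anchorItem E.length, k) := by
    intro Y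
    rw [place_append, List.mem_append, h₂, one_mul, ← prod_σ_fullVal a b η, h₁]
    simp [place, pos]
  refine ⟨⟨?_, fun j y => ?_, fun j y => ?_⟩, fun Y => (hmem Y).1⟩
  · rw [List.map_append, List.prod_append, h₁, List.take_length]
    simp [fullVal_anchorItem]
  · constructor
    · rintro ⟨Y, hY, hj, hy⟩
      rcases (hmem Y).1 hY with ⟨l, hl, hY⟩ | rfl
      · obtain ⟨rfl, rfl⟩ := ((hBs l _ (List.getElem?_eq_getElem hl)).2.1 _ j y).1
          ⟨Y, hY, hj, hy⟩
        exact ⟨hl.le, rfl⟩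
      · obtain rfl := Option.some.inj hj
        exact ⟨le_rfl, hy.symm⟩
    · rintro ⟨hj, rfl⟩
      rcases hj.lt_or_eq with hl | rfl
      · obtain ⟨Y, hY, h⟩ := ((hBs j _ (List.getElem?_eq_getElem hl)).2.1 (pos ν E j) j _).2
          ⟨rfl, rfl⟩
        exact ⟨Y, (hmem Y).2 (Or.inl ⟨j, hl, hY⟩), h⟩
      · exact ⟨_, (hmem _).2 (Or.inr rfl), rfl, rfl⟩
  · constructor
    · rintro ⟨Y, hY, hj, hy⟩
      rcases (hmem Y).1 hY with ⟨l, hl, hY⟩ | rfl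
      · obtain ⟨rfl, h⟩ := ((hBs l _ (List.getElem?_eq_getElem hl)).2.2 _ j y).1
          ⟨Y, hY, hj, hy⟩
        rw [suppSet_eq ν (List.getElem?_eq_getElem hl)]
        exact ⟨⟨Nat.le_add_left _ _, hl⟩, h⟩
      · cases hj
    · rintro ⟨⟨hj, hj'⟩, h⟩
      obtain ⟨l, rfl⟩ := Nat.exists_eq_add_of_le' hj
      have hl : l < E.length := hj'
      rw [suppSet_eq ν (List.getElem?_eq_getElem hl)] at h
      obtain ⟨Y, hY, h⟩ := ((hBs l _ (List.getElem?_eq_getElem hl)).2.2 (pos ν E l) _ y).2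
        ⟨rfl, h⟩
      exact ⟨Y, (hmem Y).2 (Or.inl ⟨l, hl, hY⟩), h⟩

end Assembly

/-! ### Comparing the solutions -/

section Solutions

variable {G H : Type*} [Group G] [Group H] {m n : ℕ} {a : Fin m → G} {b : Fin n → H}

theorem loopRel_iff {L : List (ℕ × ℕ)} {x y : Item m n} : loopRel L x y = true ↔
    (∃ p ∈ L, x.anchor = some p.1 ∧ y.anchor = some p.2) ∨
      ∃ p q, x.mark = some p ∧ y.mark = some q ∧ p.1 = q.1 := by
  rw [loopRel, Bool.or_eq_true, List.any_eq_true]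
  refine or_congr (by simp) ?_
  rcases x.mark with _ | p <;> rcases y.mark with _ | q <;> simp

theorem disjRel_iff {D : List (ℕ × ℕ)} {x y : Item m n} : disjRel D x y = true ↔
    (∃ p ∈ D, x.tag = some p.1 ∧ y.tag = some p.2) ∨
      (∃ p, x.mark = some p ∧ (y.pow = true ∨ ∃ q, y.mark = some q ∧ p.1 ≠ q.1)) := by
  rw [disjRel, Bool.or_eq_true, List.any_eq_true]
  refine or_congr (by simp) ?_
  rcases x.mark with _ | p <;> rcases y.mark with _ | q <;> simp

theorem separated_of_rel {L D : List (ℕ × ℕ)} {P : List (H × Item m n × ℕ)}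
    (hP : ∀ Y ∈ P, Y.2.1.pow = true → Y.2.1.mark = none)
    (hL : ∀ X ∈ P, ∀ Y ∈ P, loopRel L X.2.1 Y.2.1 = true → X.1 = Y.1)
    (hD : ∀ X ∈ P, ∀ Y ∈ P, disjRel D X.2.1 Y.2.1 = true →
      Disjoint (itemSupp b X) (itemSupp b Y)) : Separated b P := by
  have hsupp : ∀ X ∈ P, X.2.1.mark ≠ none → itemSupp b X = {X.1} := by
    intro X hX hm
    rcases h : X.2.1.pow with _ | _
    · rw [itemSupp, h, cond_false]
    · exact (hm (hP X hX h)).elim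
  constructor
  · intro X hX Y hY p q hp hq
    refine ⟨fun h => hL X hX Y hY (loopRel_iff.2 (Or.inr ⟨p, q, hp, hq, h⟩)), fun h => ?_⟩
    by_contra hne
    have := hD X hX Y hY (disjRel_iff.2 (Or.inr ⟨p, hp, Or.inr ⟨q, hq, hne⟩⟩))
    rw [hsupp X hX (by simp [hp]), hsupp Y hY (by simp [hq]), h] at this
    simp at this
  · intro X hX Y hY hm hpow hmem
    obtain ⟨p, hp⟩ := Option.ne_none_iff_exists'.1 hm
    have := hD X hX Y hY (disjRel_iff.2 (Or.inr ⟨p, hp, Or.inl hpow⟩))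
    rw [hsupp X hX hm] at this
    exact Set.disjoint_singleton_left.1 this hmem

theorem rel_of_separated {η ν : ℕ → ℕ} {I : HKP G H} {R : List (Item m n × ℕ)}
    (hR : RefinesExpr a b η ν I.expr R) (hν : ν ∈ I.sol)
    (hP : ∀ Y ∈ place (step b) 1 R, Y.2.1.pow = true → Y.2.1.mark = none)
    (hsep : Separated b (place (step b) 1 R)) :
    (∀ X ∈ place (step b) 1 R, ∀ Y ∈ place (step b) 1 R,
      loopRel I.loops X.2.1 Y.2.1 = true → X.1 = Y.1) ∧
    ∀ X ∈ place (step b) 1 R, ∀ Y ∈ place (step b) 1 R,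
      disjRel I.disj X.2.1 Y.2.1 = true → Disjoint (itemSupp b X) (itemSupp b Y) := by
  obtain ⟨-, hL, hD⟩ := (mem_sol_iff ν I).1 hν
  obtain ⟨-, h₂, h₃⟩ := hR
  constructor
  · intro X hX Y hY h
    rcases loopRel_iff.1 h with ⟨p, hp, h₁, h₁'⟩ | ⟨p, q, hp, hq, h⟩
    · rw [((h₂ _ _).1 ⟨X, hX, h₁, rfl⟩).2, ((h₂ _ _).1 ⟨Y, hY, h₁', rfl⟩).2]
      exact hL p hp
    · exact (hsep.1 X hX Y hY p q hp hq).1 h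
  · intro X hX Y hY h
    have hsupp : ∀ X ∈ place (step b) 1 R, X.2.1.mark ≠ none → itemSupp b X = {X.1} := by
      intro X hX hm
      rcases h : X.2.1.pow with _ | _
      · rw [itemSupp, h, cond_false]
      · exact (hm (hP X hX h)).elim
    rcases disjRel_iff.1 h with ⟨p, hp, h₁, h₁'⟩ | ⟨p, hp, hpow | ⟨q, hq, hne⟩⟩
    · refine (hD p hp).mono (fun y hy => ?_) fun y hy => ?_
      · exact ((h₃ _ _).1 ⟨X, hX, h₁, hy⟩).2
      · exact ((h₃ _ _).1 ⟨Y, hY, h₁', hy⟩).2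
    · rw [hsupp X hX (by simp [hp])]
      exact Set.disjoint_singleton_left.2 (hsep.2 X hX Y hY (by simp [hp]) hpow)
    · rw [hsupp X hX (by simp [hp]), hsupp Y hY (by simp [hq])]
      exact Set.disjoint_singleton.2 fun h => hne ((hsep.1 X hX Y hY p q hp hq).2 h)

theorem mem_sol_of_rel {η ν : ℕ → ℕ} {I : HKP G H} (hI : I.IsInstance)
    {R : List (Item m n × ℕ)}
    (hR : RefinesExpr a b η ν I.expr R) (h1 : (R.map (fullVal a b η)).prod = 1)
    (hL : ∀ X ∈ place (step b) 1 R, ∀ Y ∈ place (step b) 1 R,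
      loopRel I.loops X.2.1 Y.2.1 = true → X.1 = Y.1)
    (hD : ∀ X ∈ place (step b) 1 R, ∀ Y ∈ place (step b) 1 R,
      disjRel I.disj X.2.1 Y.2.1 = true → Disjoint (itemSupp b X) (itemSupp b Y)) :
    ν ∈ I.sol := by
  obtain ⟨h₁, h₂, h₃⟩ := hR
  refine (mem_sol_iff ν I).2 ⟨by rw [← h₁, h1], fun p hp => ?_, fun p hp => ?_⟩
  · obtain ⟨X, hX, hXa, hX'⟩ := (h₂ p.1 _).2 ⟨(hI.2.1 p hp).1, rfl⟩
    obtain ⟨Y, hY, hYa, hY'⟩ := (h₂ p.2 _).2 ⟨(hI.2.1 p hp).2, rfl⟩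
    rw [← hX', ← hY']
    exact hL X hX Y hY (loopRel_iff.2 (Or.inl ⟨p, hp, hXa, hYa⟩))
  · rw [Set.disjoint_left]
    intro y hy hy'
    obtain ⟨X, hX, hXt, hX'⟩ := (h₃ p.1 y).2 ⟨(hI.2.2 p hp).1, hy⟩
    obtain ⟨Y, hY, hYt, hY'⟩ := (h₃ p.2 y).2 ⟨(hI.2.2 p hp).2, hy'⟩
    exact Set.disjoint_left.1
      (hD X hX Y hY (disjRel_iff.2 (Or.inl ⟨p, hp, hXt, hYt⟩))) hX' hY'

theorem separated_of_obeys {κ : H → Option ℕ}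
    (hinj : ∀ y z c, κ y = some c → κ z = some c → y = z) {P : List (H × Item m n × ℕ)}
    (hP : Obeys b κ P) : Separated b P := by
  constructor
  · intro X hX Y hY p q hp hq
    have h₁ := (hP X hX).1 p hp
    have h₂ := (hP Y hY).1 q hq
    refine ⟨fun h => hinj _ _ _ h₁ (h ▸ h₂), fun h => ?_⟩
    rw [h, h₂] at h₁
    exact (Option.some.inj h₁).symm
  · intro X hX Y hY hm hpow hmem
    obtain ⟨p, hp⟩ := Option.ne_none_iff_exists'.1 hm
    have := (hP Y hY).2 hpow _ hmem
    rw [(hP X hX).1 p hp] at this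
    cases this

theorem forall_classVal_iff (η : ℕ → ℕ) (R : List (Item m n × ℕ)) :
    (∀ F ∈ classExprs (R.map Prod.fst), exprVal η (decodeExpr a F) = 1) ↔
      ∀ c, classVal a η R c = 1 := by
  rw [classExprs, List.forall_mem_map]
  simp only [exprVal_classExpr]
  refine ⟨fun h c => ?_, fun h x _ => h _⟩
  by_cases hc : ∃ r ∈ R, ∃ p, r.1.mark = some p ∧ p.1 = c
  · obtain ⟨r, hr, p, hp, rfl⟩ := hc
    have := h r.1 (List.mem_map_of_mem hr)
    rwa [hp] at this
  · refine List.prod_eq_one fun g hg => ?_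
    obtain ⟨r, hr, rfl⟩ := List.mem_map.1 hg
    exact if_neg fun h => hc ⟨r, hr, h⟩

/-- Values can be prescribed for the variables of a knapsack expression. -/
theorem IsKnapsack.exists_valuation {K : Type*} {E : ExpExpr K} (hE : IsKnapsack E)
    (e : ℕ → ℕ) : ∃ ν : ℕ → ℕ, ∀ j g x, E[j]? = some (g, some x) → ν x = e j := by
  induction E generalizing e with
  | nil => exact ⟨e, by simp⟩
  | cons α E ih =>
    obtain ⟨g, _ | x⟩ := α
    · have hE' : IsKnapsack E := by simpa [IsKnapsack] using hE
      obtain ⟨ν, hν⟩ := ih hE' fun j => e (j + 1)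
      refine ⟨ν, ?_⟩
      rintro (_ | j) g' x' h
      · simp at h
      · exact hν j g' x' (by simpa using h)
    · have hE' : x ∉ E.filterMap Prod.snd ∧ IsKnapsack E := by
        simpa [IsKnapsack, List.nodup_cons] using hE
      obtain ⟨ν, hν⟩ := ih hE'.2 fun j => e (j + 1)
      refine ⟨Function.update ν x (e 0), ?_⟩
      rintro (_ | j) g' x' h
      · simp only [List.getElem?_cons_zero, Option.some.injEq, Prod.mk.injEq] at h
        rw [← h.2, Function.update_self]
      · rw [List.getElem?_cons_succ] at h
        have hne : x' ≠ x := by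
          rintro rfl
          exact hE'.1 (List.mem_filterMap.2 ⟨_, List.mem_of_getElem? h, rfl⟩)
        rw [Function.update_of_ne hne]
        exact hν j g' x' h

theorem exists_list_of_points {X : Type*} (E : ExpExpr (Word (Fin m ⊕ Fin n)))
    (f : ℕ → ℕ → X) : ∃ l : List X, l.length = classBound E ∧
      ∀ j α, E[j]? = some α → ∀ k < α.1.length, f j k ∈ l := by
  induction E generalizing f with
  | nil => exact ⟨[], rfl, by simp⟩
  | cons α E ih =>
    obtain ⟨l, hl, h⟩ := ih fun j => f (j + 1)
    refine ⟨(List.range α.1.length).map (f 0) ++ l, ?_, ?_⟩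
    · have hc : classBound (α :: E) = α.1.length + classBound E := by simp [classBound]
      simp [hc, hl]
    · rintro (_ | j) β hβ k hk
      · simp only [List.getElem?_cons_zero, Option.some.injEq] at hβ
        subst hβ
        exact List.mem_append_left _ (List.mem_map_of_mem (List.mem_range.2 hk))
      · exact List.mem_append_right _ (h j β (by simpa using hβ) k hk)

theorem exists_classes {X : Type*} (l : List X) : ∃ κ : X → Option ℕ,
    (∀ y z c, κ y = some c → κ z = some c → y = z) ∧
    (∀ y c, κ y = some c → c < l.length) ∧ ∀ y ∈ l, κ y ≠ none := by
  classical
  have h : ∀ {y c}, (if y ∈ l then some (l.idxOf y) else none) = some c → l[c]? = some y := by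
    intro y c h
    split_ifs at h with hy
    obtain rfl := Option.some.inj h
    have hlt := List.idxOf_lt_length_iff.2 hy
    rw [List.getElem?_eq_getElem hlt, List.getElem_idxOf]
  refine ⟨fun y => if y ∈ l then some (l.idxOf y) else none, fun y z c hy hz => ?_,
    fun y c hy => ?_, fun y hy => ?_⟩
  · have := (h hy).symm.trans (h hz)
    exact Option.some.inj this
  · exact (List.getElem?_eq_some_iff.1 (h hy)).1
  · simp [hy]

end Solutions

section Main

variable {G H : Type*} [Group G] [Group H] {m n : ℕ} {a : Fin m → G} {b : Fin n → H}
  {triv : Word (Fin m ⊕ Fin n) → Bool} {c : HKPCode m n}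

theorem getElem?_decodeExpr {A : Type} {K : Type*} [Group K] (s : A → K) (E : ExpExpr (Word A))
    (j : ℕ) : (decodeExpr s E)[j]? = (E[j]?).map fun α => (evalWord s α.1, α.2) := by
  simp [decodeExpr]

theorem HKP.IsNormalized.power (hc : (HKPCode.decode a b c).IsNormalized)
    {α : Atom (Word (Fin m ⊕ Fin n))} (hα : α ∈ c.1) {x : ℕ} (hx : α.2 = some x) :
    (σ (evalWord (wreathGen a b) α.1) = 1 ∨ InGH (evalWord (wreathGen a b) α.1)) ∧
    (σ (evalWord (wreathGen a b) α.1) = 1 ∨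
      ¬ IsOfFinOrder (σ (evalWord (wreathGen a b) α.1))) := by
  have hmem : ((evalWord (wreathGen a b) α.1, α.2) : Atom (Wreath G H)) ∈
      (HKPCode.decode a b c).expr := List.mem_map.2 ⟨α, hα, rfl⟩
  have hp : Atom.IsPower (evalWord (wreathGen a b) α.1, α.2) := by simp [Atom.IsPower, hx]
  refine ⟨?_, hc.2.2.1 _ hmem hp⟩
  obtain ⟨E', g, hE, h⟩ := hc.2.1
  rw [hE] at hmem
  rcases List.mem_append.1 hmem with hmem | hmem
  · exact (h _ hmem).1 hp
  · simp [hx] at hmem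

/-- The parts of a run of a refinement. -/
theorem exists_parts {R : List (Item m n × ℕ)} (hR : R.map Prod.fst ∈ refinements triv c.1) :
    ∃ (Bs : ℕ → List (Item m n × ℕ)) (k : ℕ),
      (∀ j α, c.1[j]? = some α → (Bs j).map Prod.fst ∈ blocks triv (classBound c.1) j α) ∧
      R = (List.range c.1.length).flatMap Bs ++ [(anchorItem c.1.length, k)] := by
  obtain ⟨e, he, h⟩ := List.mem_map.1 hR
  obtain ⟨R₁, R₂, rfl, rfl, h₂⟩ := List.map_eq_append_iff.1 h.symm
  obtain ⟨Bs, hBs, rfl⟩ := mem_prefixRefinements.1 he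
  rcases R₂ with _ | ⟨⟨x, k⟩, _ | ⟨y, R₂⟩⟩
  · simp at h₂
  · simp only [List.map_cons, List.map_nil, List.cons.injEq, and_true] at h₂
    subst h₂
    refine ⟨Bs, k, fun j α hα => ?_, rfl⟩
    obtain ⟨β, hβ, h⟩ := hBs j (List.getElem?_eq_some_iff.1 hα).1
    rw [hα] at hβ
    obtain rfl := Option.some.inj hβ
    exact h
  · simp at h₂

theorem items_props (ht : ∀ w, triv w = true ↔ σ (evalWord (wreathGen a b) w) = 1)
    {e : List (Item m n)}
    (he : e ∈ prefixRefinements triv (classBound c.1) c.1 c.1.length) {x : Item m n}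
    (hx : x ∈ e) :
    (x.pow = true → x.mark = none ∧ (∃ y, (x.word, some y) ∈ c.1) ∧
      σ (evalWord (wreathGen a b) x.word) ≠ 1) ∧
    (x.pow = false → InH (evalWord (wreathGen a b) x.word)) := by
  rw [← runOf_map_fst e 0] at he hx
  obtain ⟨Bs, hBs, h⟩ := mem_prefixRefinements.1 he
  rw [h] at hx
  obtain ⟨r, hr, rfl⟩ := List.mem_map.1 hx
  obtain ⟨j, hj, hr⟩ := List.mem_flatMap.1 hr
  obtain ⟨α, hα, hB⟩ := hBs j (List.mem_range.1 hj)
  obtain ⟨h₁, h₂⟩ := blocks_props ht hB (List.mem_map_of_mem hr)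
  refine ⟨fun hp => ?_, h₂⟩
  obtain ⟨hm, hw, ⟨y, hy⟩, hσ⟩ := h₁ hp
  refine ⟨hm, ⟨y, ?_⟩, hw ▸ hσ⟩
  rw [hw, ← hy]
  exact List.mem_of_getElem? hα

theorem goodItem_of_mem_refinements
    (ht : ∀ w, triv w = true ↔ σ (evalWord (wreathGen a b) w) = 1)
    (hc : (HKPCode.decode a b c).IsNormalized) {e : List (Item m n)}
    (he : e ∈ refinements triv c.1) {x : Item m n} (hx : x ∈ e) : GoodItem a b x := by
  obtain ⟨f, hf, rfl⟩ := List.mem_map.1 he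
  rcases List.mem_append.1 hx with hx | hx
  · obtain ⟨h₁, h₂⟩ := items_props ht hf hx
    refine ⟨fun hp => ?_, h₂⟩
    obtain ⟨hm, ⟨y, hy⟩, hσ⟩ := h₁ hp
    exact ⟨hm, (hc.power hy rfl).1.resolve_left hσ⟩
  · obtain rfl := List.mem_singleton.1 hx
    exact ⟨fun h => (by cases h), fun _ => ⟨1, by simp [anchorItem, Item.word]⟩⟩

/-- A solution of the instance gives a solution of a refinement. -/
theorem exists_solution_of_mem_sol
    (ht : ∀ w, triv w = true ↔ σ (evalWord (wreathGen a b) w) = 1)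
    (hc : (HKPCode.decode a b c).IsNormalized) {ν : ℕ → ℕ}
    (hν : ν ∈ (HKPCode.decode a b c).sol) :
    ∃ e ∈ refinements triv c.1,
      (∃ η : ℕ → ℕ, ∀ F ∈ classExprs e, exprVal η (decodeExpr a F) = 1) ∧
      (HKPCode.decode a b (outCode c.2.1 c.2.2 e)).sol.Nonempty := by
  set E := decodeExpr (wreathGen a b) c.1 with hE
  have hlen : E.length = c.1.length := by simp [hE, decodeExpr]
  set η : ℕ → ℕ := fun x => ν x - 1 with hη
  obtain ⟨l, hl, hlmem⟩ := exists_list_of_points c.1 fun j k =>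
    pos ν E j * σ (evalWord (wreathGen a b) (((c.1[j]?).elim [] Prod.fst).take k))
  obtain ⟨κ, hinj, hN, hκ⟩ := exists_classes l
  have hB : ∀ j, ∃ B : List (Item m n × ℕ), ∀ α, c.1[j]? = some α →
      B.map Prod.fst ∈ blocks triv (classBound c.1) j α ∧
      Refines a b η ν j (evalWord (wreathGen a b) α.1, α.2) B ∧
      Obeys b κ (place (step b) (pos ν E j) B) := by
    intro j
    rcases hj : c.1[j]? with _ | α
    · exact ⟨[], by simp⟩
    · have hα := List.mem_of_getElem? hj
      obtain ⟨B, hB⟩ := exists_block (triv := triv) (η := η) (ν := ν) ht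
        (fun x hx => by simp only [hη]; omega) hinj
        (fun y d h => (hN y d h).trans_eq hl) j (α := α) (fun x hx => (hc.power hα hx).1)
        (fun x hx => (hc.power hα hx).2) (pos ν E j) (fun k hk => hκ _ (by
          have := hlmem j α hj k hk
          rwa [hj] at this))
      refine ⟨B, fun β hβ => ?_⟩
      obtain rfl := Option.some.inj hβ
      exact hB
  choose Bs hBs using hB
  have hBsE : ∀ j α, E[j]? = some α → Refines a b η ν j α (Bs j) := by
    intro j α hα
    rw [hE, getElem?_decodeExpr, Option.map_eq_some_iff] at hα
    obtain ⟨β, hβ, rfl⟩ := hα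
    exact (hBs j β hβ).2.1
  obtain ⟨href, hmem⟩ := refinesExpr_of_blocks hBsE 0
  set R := (List.range E.length).flatMap Bs ++ [((anchorItem E.length : Item m n), 0)] with hR
  have hRe : R.map Prod.fst ∈ refinements triv c.1 := by
    refine List.mem_map.2 ⟨((List.range c.1.length).flatMap Bs).map Prod.fst,
      mem_prefixRefinements.2 ⟨Bs, fun j hj => ?_, rfl⟩, by simp [hR, hlen]⟩
    exact ⟨_, List.getElem?_eq_getElem hj, (hBs j _ (List.getElem?_eq_getElem hj)).1⟩
  have hgood : ∀ r ∈ R, GoodItem a b r.1 := fun r hr =>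
    goodItem_of_mem_refinements ht hc hRe (List.mem_map_of_mem hr)
  have hobey : Obeys b κ (place (step b) 1 R) := by
    intro Y hY
    rcases hmem Y hY with ⟨j, hj, hY⟩ | rfl
    · rw [hlen] at hj
      exact (hBs j _ (List.getElem?_eq_getElem hj)).2.2 Y hY
    · exact ⟨fun q hq => (Option.some_ne_none _ hq.symm).elim,
        fun h => (Bool.false_ne_true h).elim⟩
  have hsep := separated_of_obeys hinj hobey
  have hfull : (R.map (fullVal a b η)).prod = 1 := by
    rw [href.1]
    exact ((mem_sol_iff ν _).1 hν).1
  obtain ⟨hbare, hclass⟩ := (prod_fullVal_eq_one_iff a b η hgood hsep).1 hfull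
  obtain ⟨hL, hD⟩ := rel_of_separated (I := HKPCode.decode a b c) href hν
    (fun Y hY hp => ((hgood _ (mem_of_mem_place _ hY)).1 hp).1) hsep
  refine ⟨_, hRe, ⟨η, (forall_classVal_iff η R).2 hclass⟩,
    fun k => (R[k]?).elim 0 Prod.snd, ?_⟩
  rw [mem_sol_outCode_iff, ← eq_runOf]
  exact ⟨hbare, hL, hD⟩

/-- A solution of a refinement gives a solution of the instance. -/
theorem sol_nonempty_of_solution
    (ht : ∀ w, triv w = true ↔ σ (evalWord (wreathGen a b) w) = 1)
    (hc : (HKPCode.decode a b c).IsNormalized) {e : List (Item m n)}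
    (he : e ∈ refinements triv c.1) {η : ℕ → ℕ}
    (hη : ∀ F ∈ classExprs e, exprVal η (decodeExpr a F) = 1)
    (hsol : (HKPCode.decode a b (outCode c.2.1 c.2.2 e)).sol.Nonempty) :
    (HKPCode.decode a b c).sol.Nonempty := by
  obtain ⟨μ, hμ⟩ := hsol
  rw [mem_sol_outCode_iff] at hμ
  obtain ⟨hbare, hL, hD⟩ := hμ
  have hRe := he
  rw [← runOf_map_fst e μ] at hRe hη
  set R := runOf e μ
  have hgood : ∀ r ∈ R, GoodItem a b r.1 := fun r hr =>
    goodItem_of_mem_refinements ht hc hRe (List.mem_map_of_mem hr)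
  have hsep := separated_of_rel
    (fun Y hY hp => ((hgood _ (mem_of_mem_place _ hY)).1 hp).1) hL hD
  have hfull := (prod_fullVal_eq_one_iff a b η hgood hsep).2
    ⟨hbare, (forall_classVal_iff η R).1 hη⟩
  obtain ⟨Bs, k, hBs, hR⟩ := exists_parts hRe
  have hex : ∀ j, ∃ x, ∀ α, c.1[j]? = some α → ∀ ν : ℕ → ℕ, (∀ y, α.2 = some y → ν y = x) →
      Refines a b η ν j (evalWord (wreathGen a b) α.1, α.2) (Bs j) := by
    intro j
    rcases hj : c.1[j]? with _ | α
    · exact ⟨0, by simp⟩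
    · obtain ⟨x, hx⟩ := refines_of_mem_blocks ht η
        (fun y hy => (hc.power (List.mem_of_getElem? hj) hy).1) (hBs j α hj)
      refine ⟨x, fun β hβ => ?_⟩
      obtain rfl := Option.some.inj hβ
      exact hx
  choose x hx using hex
  obtain ⟨ν, hν⟩ := hc.1.1.exists_valuation x
  have hBsE : ∀ j α, (HKPCode.decode a b c).expr[j]? = some α →
      Refines a b η ν j α (Bs j) := by
    intro j α hα
    have hα' := hα
    rw [HKPCode.decode, getElem?_decodeExpr, Option.map_eq_some_iff] at hα'
    obtain ⟨β, hβ, rfl⟩ := hα'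
    exact hx j β hβ ν fun y hy => hν j _ y (by rw [hα, hy])
  obtain ⟨href, -⟩ := refinesExpr_of_blocks hBsE k
  have hlen : (HKPCode.decode a b c).expr.length = c.1.length := by
    simp [HKPCode.decode, decodeExpr]
  rw [hlen, ← hR] at href
  exact ⟨ν, mem_sol_of_rel hc.1 href hfull hL hD⟩

end Main

end WreathKnapsack

theorem mainTheorem2 {G H : Type*} [Group G] [Group H] {m n : ℕ}
    (a : Fin m → G) (b : Fin n → H)
    (ha : Subgroup.closure (Set.range a) = ⊤) (hb : Subgroup.closure (Set.range b) = ⊤)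
    (hG : ExpEqDecidable a) (hH : WordProblemDecidable b) :
    ∃ F : HKPCode m n → List (HKPCode m n), Computable F ∧
      ∀ c : HKPCode m n, (HKPCode.decode a b c).IsNormalized →
        (∀ d ∈ F c, (HKPCode.decode a b d).IsNormalized ∧ (HKPCode.decode a b d).StackingFree) ∧
        ((HKPCode.decode a b c).sol.Nonempty ↔
          ∃ d ∈ F c, (HKPCode.decode a b d).sol.Nonempty) := by
  obtain ⟨solv, hsolv, hs⟩ := ComputablePred.computable_iff.1 hG
  obtain ⟨t, ht, hT⟩ := ComputablePred.computable_iff.1 hH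
  have hs' : ∀ S : List (ExpExpr (Word (Fin m))), solv S = true ↔
      ∃ ν : ℕ → ℕ, ∀ E ∈ S, exprVal ν (decodeExpr a E) = 1 :=
    fun S => (congrFun hs S).symm.to_iff
  have hT' : ∀ w : Word (Fin m ⊕ Fin n), t (hWord w) = true ↔
      σ (evalWord (wreathGen a b) w) = 1 := fun w => by
    rw [σ_evalWord]
    exact (congrFun hT (hWord w)).symm.to_iff
  refine ⟨stackingFreeInstances (fun w => t (hWord w)) solv,
    computable_stackingFreeInstances (ht.comp computable_hWord) hsolv,
    fun c hc => ⟨fun d hd => ?_, fun ⟨ν, hν⟩ => ?_, ?_⟩⟩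
  · obtain ⟨e, he, rfl⟩ := List.mem_map.1 hd
    obtain ⟨f, hf, rfl⟩ := List.mem_map.1 (List.mem_filter.1 he).1
    exact outCode_normalized a b hc
      (fun x hx hp => ((items_props hT' hf hx).1 hp).2)
      (fun x hx hp => (items_props hT' hf hx).2 hp) _ _
  · obtain ⟨e, he, hη, h⟩ := exists_solution_of_mem_sol hT' hc hν
    exact ⟨_, List.mem_map.2 ⟨e, List.mem_filter.2 ⟨he, (hs' _).2 hη⟩, rfl⟩, h⟩
  · rintro ⟨d, hd, h⟩
    obtain ⟨e, he, rfl⟩ := List.mem_map.1 hd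
    obtain ⟨he, hsolve⟩ := List.mem_filter.1 he
    obtain ⟨η, hη⟩ := (hs' _).1 hsolve
    exact sol_nonempty_of_solution hT' hc he hη h
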